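/- Let $X$ and $U_1,\dots,U_n$ be Hilbert spaces and let $A$ be the generator of a strongly continuous semigroup $(T_t)_{t\ge 0}$ on $X$ that is exponentially stable, i.e. $\|T_t\|\le M_1e^{-\mu_1t}$ for all $t\ge0$, with some $M_1,\mu_1>0$. Let $X_{-1}$ be the dual of $\mathcal D(A^*)$ (with the graph norm) with respect to the pivot space $X$; thus $X\subset X_{-1}$, and $A$ and $T_t$ extend to bounded operators $A:X\to X_{-1}$ and $T_t:X_{-1}\to X_{-1}$. Let $B_i\in\mathcal L(U_i,X_{-1})$, $i=1,\dots,n$, be admissible control operators: for some $\tau>0$ one has $\int_0^\tau T_{\tau-\sigma}B_iu(\sigma)\,d\sigma\in X$ for every $u\in L^2([0,\infty),U_i)$ (the integral being taken in $X_{-1}$). Let $x_0\in X$ and $u_i\in L^2_{loc}([0,\infty),U_i)$, $i=1,\dots,n$. A solution of the initial value problem $$\dot x(t)=Ax(t)+\sum_{i=1}^nB_iu_i(t),\qquad x(0)=x_0,$$ is a function $x:[0,\infty)\to X$ with $x(0)=x_0$ that belongs to $L^1_{loc}([0,\infty),X)\cap C([0,\infty),X_{-1})$ and satisfies, for every $t\ge0$,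 the equation $x(t)-x(0)=\int_0^t\big[Ax(\sigma)+\sum_{i=1}^n B_iu_i(\sigma)\big]\,d\sigma$ in $X_{-1}$. Then this problem has exactly one solution $x$, and $x\in C([0,\infty),X)$. Moreover: 1. If $u_i\in L^\infty([0,\infty),U_i)$ for all $i$, then $x$ is bounded: $\sup_{t\ge0}\|x(t)\|_X<\infty$. 2. If for each $i$ either $u_i\in L^2([0,\infty),U_i)$ or $\lim_{t\to\infty}\|u_i(t)\|_{U_i}=0$ (the limit disregarding a null set of times $t$), then $x(t)\to0$ in $X$ as $t\to\infty$. 3. If there are constants $M_0,\mu_0>0$ such that $\|u_i(t)\|_{U_i}\le M_0e^{-\mu_0t}$ for almost every $t\ge0$ and all $i$, then there are $M,\mu>0$ such that $\|x(t)\|_X\le Me^{-\mu t}$ for all $t\ge0$. -/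

import Mathlib

open Filter Topology MeasureTheory Set
open scoped NNReal ENNReal LinearPMap

/-- A strongly continuous (`C₀`) operator semigroup on `X`. -/
structure C0Semigroup (𝕜 X : Type*) [RCLike 𝕜] [NormedAddCommGroup X] [InnerProductSpace 𝕜 X] where
  toFun : ℝ≥0 → X →L[𝕜] X
  apply_zero : toFun 0 = ContinuousLinearMap.id 𝕜 X
  apply_add : ∀ s t, toFun (s + t) = (toFun s).comp (toFun t)
  strongly_continuous : ∀ x, Tendsto (fun t => toFun t x) (𝓝 0) (𝓝 x)

noncomputable section

namespace C0Semigroup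

variable {𝕜 X : Type*} [RCLike 𝕜] [NormedAddCommGroup X] [InnerProductSpace 𝕜 X]

/-- `‖T t‖ ≤ M e^{-ω t}` for some `M, ω > 0` and all `t ≥ 0`. -/
def ExponentiallyStable (T : C0Semigroup 𝕜 X) : Prop :=
  ∃ M > 0, ∃ ω > 0, ∀ t : ℝ≥0, ‖T.toFun t‖ ≤ M * Real.exp (-ω * t)

/-- The difference quotient `(T t x - x) / t`. -/
def diffQuot (T : C0Semigroup 𝕜 X) (x : X) (t : ℝ≥0) : X :=
  ((t : ℝ) : 𝕜)⁻¹ • (T.toFun t x - x)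

theorem diffQuot_add (T : C0Semigroup 𝕜 X) (x y : X) (t : ℝ≥0) :
    T.diffQuot (x + y) t = T.diffQuot x t + T.diffQuot y t := by
  simp only [diffQuot, map_add, ← smul_add]
  congr 1
  abel

theorem diffQuot_smul (T : C0Semigroup 𝕜 X) (c : 𝕜) (x : X) (t : ℝ≥0) :
    T.diffQuot (c • x) t = c • T.diffQuot x t := by
  simp only [diffQuot, map_smul, ← smul_sub]
  exact smul_comm _ _ _

/-- The domain of the generator: all `x` for which the difference quotient converges as `t ↓ 0`. -/
def generatorDomain (T : C0Semigroup 𝕜 X) : Submodule 𝕜 X where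
  carrier := {x | ∃ y, Tendsto (T.diffQuot x) (𝓝[>] 0) (𝓝 y)}
  zero_mem' := ⟨0, by
    have : T.diffQuot 0 = fun _ => 0 := by
      funext t
      simp [diffQuot]
    rw [this]
    exact tendsto_const_nhds⟩
  add_mem' := by
    rintro a b ⟨y, hy⟩ ⟨z, hz⟩
    exact ⟨y + z, (hy.add hz).congr fun t => (T.diffQuot_add a b t).symm⟩
  smul_mem' := by
    rintro c a ⟨y, hy⟩
    exact ⟨c • y, (hy.const_smul c).congr fun t => (T.diffQuot_smul c a t).symm⟩

theorem tendsto_choose (T : C0Semigroup 𝕜 X) (x : T.generatorDomain) :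
    Tendsto (T.diffQuot x) (𝓝[>] 0) (𝓝 x.2.choose) :=
  x.2.choose_spec

/-- The infinitesimal generator `A` of the semigroup, `A x = lim_{t ↓ 0} (T t x - x) / t`. -/
def generator (T : C0Semigroup 𝕜 X) : X →ₗ.[𝕜] X where
  domain := T.generatorDomain
  toFun :=
    { toFun := fun x => x.2.choose
      map_add' := fun x y => tendsto_nhds_unique (T.tendsto_choose (x + y))
        (((T.tendsto_choose x).add (T.tendsto_choose y)).congr fun t =>
          (T.diffQuot_add x y t).symm)
      map_smul' := fun c x => tendsto_nhds_unique (T.tendsto_choose (c • x))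
        (((T.tendsto_choose x).const_smul c).congr fun t => (T.diffQuot_smul c x t).symm) }

theorem generator_tendsto (T : C0Semigroup 𝕜 X) (x : T.generator.domain) :
    Tendsto (T.diffQuot x) (𝓝[>] 0) (𝓝 (T.generator x)) :=
  T.tendsto_choose x

theorem map_diffQuot (T : C0Semigroup 𝕜 X) (s : ℝ≥0) (x : X) (t : ℝ≥0) :
    T.toFun s (T.diffQuot x t) = T.diffQuot (T.toFun s x) t := by
  have h : T.toFun s (T.toFun t x) = T.toFun t (T.toFun s x) := by
    rw [← ContinuousLinearMap.comp_apply, ← ContinuousLinearMap.comp_apply, ← T.apply_add,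
      ← T.apply_add, add_comm]
  simp only [diffQuot, map_smul, map_sub, h]

theorem map_mem_domain (T : C0Semigroup 𝕜 X) (s : ℝ≥0) (x : T.generator.domain) :
    T.toFun s x ∈ T.generator.domain :=
  ⟨T.toFun s (T.generator x), (((T.toFun s).continuous.tendsto _).comp
    (T.generator_tendsto x)).congr fun t => T.map_diffQuot s x t⟩

theorem generator_map (T : C0Semigroup 𝕜 X) (s : ℝ≥0) (x : T.generator.domain) :
    T.generator ⟨T.toFun s x, T.map_mem_domain s x⟩ = T.toFun s (T.generator x) :=
  tendsto_nhds_unique (T.generator_tendsto _)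
    ((((T.toFun s).continuous.tendsto _).comp (T.generator_tendsto x)).congr fun t =>
      T.map_diffQuot s x t)

variable [CompleteSpace X]

/-- The space `D(A*)` with the graph norm, realized as the graph of the adjoint of the generator:
its elements are the pairs `p = (φ, A* φ)` with `φ ∈ D(A*)`, with norm `max ‖φ‖ ‖A* φ‖`. -/
def AdjDomain (T : C0Semigroup 𝕜 X) : Type _ := T.generator†.graph

instance (T : C0Semigroup 𝕜 X) : NormedAddCommGroup T.AdjDomain :=
  inferInstanceAs (NormedAddCommGroup T.generator†.graph)

instance (T : C0Semigroup 𝕜 X) : NormedSpace 𝕜 T.AdjDomain :=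
  inferInstanceAs (NormedSpace 𝕜 T.generator†.graph)

/-- The inclusion `(φ, A* φ) ↦ (φ, A* φ)` of the graph of `A*` into `X × X`. -/
def AdjDomain.incl (T : C0Semigroup 𝕜 X) : T.AdjDomain →L[𝕜] X × X :=
  T.generator†.graph.subtypeL

/-- The extrapolation space `X₋₁`: the dual of `D(A*)` with respect to the pivot space `X`, that
is, the space of bounded conjugate-linear functionals on `D(A*)`. -/
abbrev Xneg (T : C0Semigroup 𝕜 X) : Type _ := T.AdjDomain →L⋆[𝕜] 𝕜

/-- The embedding of the pivot space `X` into `X₋₁`: `x` acts as `φ ↦ ⟨φ, x⟩`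
(Mathlib's inner product is conjugate-linear in the first argument). -/
def embed (T : C0Semigroup 𝕜 X) : X →L[𝕜] T.Xneg :=
  ((innerSL 𝕜).comp ((ContinuousLinearMap.fst 𝕜 X X).comp (AdjDomain.incl T))).flip

/-- The extension `A : X → X₋₁` of the generator: `A x` acts as `φ ↦ ⟨A* φ, x⟩`. -/
def genExt (T : C0Semigroup 𝕜 X) : X →L[𝕜] T.Xneg :=
  ((innerSL 𝕜).comp ((ContinuousLinearMap.snd 𝕜 X X).comp (AdjDomain.incl T))).flip

/-- `D(A*)` is invariant under `T(s)*`, and `A*` commutes with `T(s)*` there. -/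
theorem adjoint_map_mem (T : C0Semigroup 𝕜 X) (s : ℝ≥0) (p : X × X)
    (hp : p ∈ T.generator†.graph) :
    ((T.toFun s).adjoint p.1, (T.toFun s).adjoint p.2) ∈ T.generator†.graph := by
  by_cases hd : Dense (T.generator.domain : Set X)
  · rw [LinearPMap.adjoint_graph_eq_graph_adjoint hd] at hp ⊢
    rw [Submodule.mem_adjoint_iff] at hp ⊢
    intro a b hab
    obtain ⟨x, rfl, rfl⟩ := (LinearPMap.mem_graph_iff _).1 hab
    rw [ContinuousLinearMap.adjoint_inner_right, ContinuousLinearMap.adjoint_inner_right,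
      ← T.generator_map]
    exact hp _ _ ((LinearPMap.mem_graph_iff _).2 ⟨_, rfl, rfl⟩)
  · obtain ⟨φ, h1, h2⟩ := (LinearPMap.mem_graph_iff _).1 hp
    rw [LinearPMap.adjoint_apply_of_not_dense hd] at h2
    have hφ := (LinearPMap.mem_adjoint_domain_iff _ _).1 φ.2
    have hm : (T.toFun s).adjoint p.1 ∈ T.generator†.domain := by
      rw [LinearPMap.mem_adjoint_domain_iff, ← h1]
      have hc : Continuous fun x : T.generator.domain =>
          (⟨T.toFun s x, T.map_mem_domain s x⟩ : T.generator.domain) := by fun_prop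
      refine (hφ.comp hc).congr fun x => ?_
      change inner 𝕜 (φ : X) (T.generator ⟨T.toFun s x, T.map_mem_domain s x⟩) =
        inner 𝕜 ((T.toFun s).adjoint φ) (T.generator x)
      rw [T.generator_map, ContinuousLinearMap.adjoint_inner_left]
    refine (LinearPMap.mem_graph_iff _).2 ⟨⟨_, hm⟩, rfl, ?_⟩
    rw [LinearPMap.adjoint_apply_of_not_dense hd, ← h2, map_zero]

/-- The restriction of `T(s)*` to `D(A*)`. -/
def adjMap (T : C0Semigroup 𝕜 X) (s : ℝ≥0) : T.AdjDomain →L[𝕜] T.AdjDomain :=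
  (((T.toFun s).adjoint.prodMap (T.toFun s).adjoint).comp (AdjDomain.incl T)).codRestrict
    T.generator†.graph fun p => T.adjoint_map_mem s (AdjDomain.incl T p) p.2

/-- The extension of `T(s)` to `X₋₁`: `(T(s) f)(φ) = f (T(s)* φ)`. -/
def ext (T : C0Semigroup 𝕜 X) (s : ℝ≥0) (f : T.Xneg) : T.Xneg :=
  f.comp (T.adjMap s)

variable {U : Type*} [NormedAddCommGroup U] [InnerProductSpace 𝕜 U]

/-- `Φ_τ u = ∫₀^τ T(τ - σ) B u(σ) dσ`, a Bochner integral in `X₋₁`. -/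
def inputMap (T : C0Semigroup 𝕜 X) (B : U →L[𝕜] T.Xneg) (τ : ℝ) (u : ℝ → U) : T.Xneg :=
  ∫ σ in (0 : ℝ)..τ, T.ext (τ - σ).toNNReal (B (u σ))

/-- `B ∈ L(U, X₋₁)` is an admissible control operator: for some `τ > 0`, `Φ_τ` maps
`L²([0,∞), U)` into `X`. -/
def Admissible (T : C0Semigroup 𝕜 X) (B : U →L[𝕜] T.Xneg) : Prop :=
  ∃ τ > 0, ∀ u : ℝ → U, MemLp u 2 (volume.restrict (Ici 0)) →
    ∃ x : X, T.embed x = T.inputMap B τ u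

/-- `x` is a solution of `x' = A x + f` in `X₋₁` on `[0, ∞)`: it is in `L¹_loc([0,∞), X)` and in
`C([0,∞), X₋₁)`, and `x(t) - x(0) = ∫₀ᵗ (A x(σ) + f(σ)) dσ` holds in `X₋₁` for all `t ≥ 0`. -/
structure IsSolution (T : C0Semigroup 𝕜 X) (f : ℝ → T.Xneg) (x : ℝ → X) : Prop where
  locallyIntegrable : LocallyIntegrableOn x (Ici 0)
  continuousOn : ContinuousOn (fun t => T.embed (x t)) (Ici 0)
  eq : ∀ t ≥ 0, T.embed (x t) - T.embed (x 0) = ∫ σ in (0 : ℝ)..t, (T.genExt (x σ) + f σ)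

end C0Semigroup

end

/-- `u ∈ L²_loc([0,∞), U)`. -/
def MemL2Loc {U : Type*} [NormedAddCommGroup U] (u : ℝ → U) : Prop :=
  ∀ t ≥ 0, MemLp u 2 (volume.restrict (Icc (0 : ℝ) t))

/-! Exponential stability makes `R x = -∫₀^∞ T_s x ds` converge, and `R` is the inverse of `A`. The
extended generator `genExt` is then an isomorphism of `X` onto `X₋₁`, and under it the embedding `X
⊂ X₋₁` becomes `R` itself (`embed_eq`). Writing `B i = genExt ∘ b i`, every statement in `X₋₁`
becomes one in `X`: a solution satisfies `R x(t) - R x(0) = ∫₀ᵗ (x + v)` with `v = ∑ b i (u i)`, and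
admissibility says that the mild integral of `b i (u i)` lies in the range of the injective operator
`R`.

Existence: by the closed graph theorem the map from inputs in `L²(ℝ, U)` to states is a bounded
operator `Φ` (`exists_inputOperator`). The state at time `t` is `Φ` applied to the cut-off input
translated by `t`; translations are strongly continuous isometries of `L²`, which gives continuity
in `X` and a bound uniform in `t`.

Uniqueness: a difference `d` of solutions satisfies `R d = ∫ d`, and commuting the two convolutions,
with the semigroup and with `1`, forces `R (R d) = 0` (`eq_zero_of_eq_integral`).

Asymptotics: for a multiple `L` of `τ` with `M e^{-ωL} ≤ 1/2`, the state halves over each step of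
length `L`, up to `K` times the `L²` norm of the input on that step (`exists_blockStable`). The
three claims follow from the scalar recursion `a (k+1) ≤ a k / 2 + c k` with `c` bounded, null or
geometric. -/

namespace C0Semigroup

/-! ### Orbits of an exponentially stable semigroup. -/

section

variable {𝕜 X : Type*} [RCLike 𝕜] [NormedAddCommGroup X] [InnerProductSpace 𝕜 X]

/-- The semigroup, indexed by real times (constant equal to the identity for negative times). -/
abbrev realMap (T : C0Semigroup 𝕜 X) (t : ℝ) : X →L[𝕜] X := T.toFun t.toNNReal

theorem realMap_add (T : C0Semigroup 𝕜 X) {s t : ℝ} (hs : 0 ≤ s) (ht : 0 ≤ t) (x : X) :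
    T.realMap (s + t) x = T.realMap s (T.realMap t x) := by
  rw [realMap, Real.toNNReal_add hs ht, T.apply_add]
  rfl

theorem realMap_zero (T : C0Semigroup 𝕜 X) (x : X) : T.realMap 0 x = x := by
  simp [realMap, T.apply_zero]

/-- The semigroup is bounded with bound `M` and decay rate `ω`. -/
structure HasDecay (T : C0Semigroup 𝕜 X) (M ω : ℝ) : Prop where
  pos : 0 < M
  rate_pos : 0 < ω
  norm_le : ∀ t : ℝ≥0, ‖T.toFun t‖ ≤ M * Real.exp (-ω * t)

variable {T : C0Semigroup 𝕜 X} {M ω : ℝ}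

theorem HasDecay.norm_realMap_le (h : T.HasDecay M ω) {t : ℝ} (ht : 0 ≤ t) (x : X) :
    ‖T.realMap t x‖ ≤ M * Real.exp (-ω * t) * ‖x‖ := by
  have := h.norm_le t.toNNReal
  rw [Real.coe_toNNReal _ ht] at this
  exact (ContinuousLinearMap.le_opNorm _ _).trans (by gcongr)

theorem HasDecay.norm_toFun_le (h : T.HasDecay M ω) (t : ℝ≥0) (x : X) :
    ‖T.toFun t x‖ ≤ M * ‖x‖ := by
  refine (ContinuousLinearMap.le_opNorm _ _).trans ?_
  gcongr
  refine (h.norm_le t).trans ?_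
  have : Real.exp (-ω * t) ≤ 1 := Real.exp_le_one_iff.2
    (by have := mul_nonneg h.rate_pos.le t.2; simp only [NNReal.val_eq_coe] at this; linarith)
  nlinarith [h.pos]

/-- Factoring out the smaller time, `T_t - T_s = T_s (T_{t-s} - 1)`, reduces two-sided continuity at
`s` to continuity at `0`. -/
theorem HasDecay.dist_le (h : T.HasDecay M ω) (s t : ℝ≥0) (x : X) :
    dist (T.toFun t x) (T.toFun s x) ≤ M * ‖T.toFun (nndist t s) x - x‖ := by
  wlog hst : s ≤ t generalizing s t
  · rw [dist_comm, nndist_comm]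
    exact this _ _ (le_of_not_ge hst)
  have hn : t = s + nndist t s := by
    rw [NNReal.nndist_eq, max_eq_left (by simp [tsub_eq_zero_of_le hst]), add_tsub_cancel_of_le hst]
  have : T.toFun t x - T.toFun s x = T.toFun s (T.toFun (nndist t s) x - x) := by
    conv_lhs => rw [hn]
    rw [T.apply_add, map_sub]
    rfl
  rw [dist_eq_norm, this]
  exact h.norm_toFun_le _ _

theorem HasDecay.continuous_orbit (h : T.HasDecay M ω) (x : X) :
    Continuous fun t => T.toFun t x := by
  rw [continuous_iff_continuousAt]
  intro s
  rw [ContinuousAt, tendsto_iff_dist_tendsto_zero]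
  have h1 : Tendsto (fun t => nndist t s) (𝓝 s) (𝓝 0) := by
    have : Continuous fun t : ℝ≥0 => nndist t s := by fun_prop
    simpa using this.tendsto s
  have h2 := (((T.strongly_continuous x).comp h1).sub_const x).norm.const_mul M
  simp only [sub_self, norm_zero, mul_zero] at h2
  exact squeeze_zero (fun _ => dist_nonneg) (fun t => h.dist_le s t x) h2

/-- Strong continuity and the uniform bound give joint continuity. It supplies the measurability of
integrands in which both the time and the vector vary. -/
theorem HasDecay.continuous_uncurry (h : T.HasDecay M ω) :
    Continuous fun p : ℝ≥0 × X => T.toFun p.1 p.2 := by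
  rw [continuous_iff_continuousAt]
  rintro ⟨s, x⟩
  have h1 : Tendsto (fun p : ℝ≥0 × X => M * ‖p.2 - x‖ + ‖T.toFun p.1 x - T.toFun s x‖)
      (𝓝 (s, x)) (𝓝 0) := by
    have hc : Continuous fun p : ℝ≥0 × X => M * ‖p.2 - x‖ + ‖T.toFun p.1 x - T.toFun s x‖ := by
      have := (h.continuous_orbit x).comp (continuous_fst (X := ℝ≥0) (Y := X))
      simp only [Function.comp_def] at this
      fun_prop
    simpa using hc.tendsto (s, x)
  rw [ContinuousAt, tendsto_iff_dist_tendsto_zero]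
  refine squeeze_zero (fun _ => dist_nonneg) (fun p => ?_) h1
  rw [dist_eq_norm]
  calc ‖T.toFun p.1 p.2 - T.toFun s x‖
      = ‖T.toFun p.1 (p.2 - x) + (T.toFun p.1 x - T.toFun s x)‖ := by rw [map_sub]; congr 1; abel
    _ ≤ _ := (norm_add_le _ _).trans (add_le_add_left (h.norm_toFun_le _ _) _)

theorem HasDecay.continuous_realMap (h : T.HasDecay M ω) (x : X) :
    Continuous fun t : ℝ => T.realMap t x :=
  (h.continuous_orbit x).comp continuous_real_toNNReal

theorem HasDecay.continuous_realMap_apply (h : T.HasDecay M ω) :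
    Continuous fun p : ℝ × X => T.realMap p.1 p.2 :=
  h.continuous_uncurry.comp
    ((continuous_real_toNNReal.comp continuous_fst).prodMk continuous_snd)

theorem HasDecay.integrableOn (h : T.HasDecay M ω) (x : X) :
    IntegrableOn (fun s => T.realMap s x) (Ioi 0) := by
  have h1 : IntegrableOn (fun s => M * Real.exp (-ω * s) * ‖x‖) (Ioi 0) :=
    ((integrableOn_exp_mul_Ioi (by linarith [h.rate_pos]) 0).const_mul M).mul_const _
  refine Integrable.mono' h1 (h.continuous_realMap x).aestronglyMeasurable ?_
  filter_upwards [ae_restrict_mem measurableSet_Ioi] with s hs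
  exact h.norm_realMap_le (le_of_lt hs) x

/-! ### The inverse of the generator. -/

variable [NormedSpace ℝ X]

/-- `R` inverts the generator of `T`, in integrated form. -/
structure IsGeneratorInverse (T : C0Semigroup 𝕜 X) (R : X →L[𝕜] X) : Prop where
  comm : ∀ t x, T.toFun t (R x) = R (T.toFun t x)
  eq_integral : ∀ t : ℝ, 0 ≤ t → ∀ x, R (T.realMap t x - x) = ∫ s in (0 : ℝ)..t, T.realMap s x

/-- The witness is `-∫₀^∞ T_s x ds`. Applying `T_t` inside moves the domain to `(t, ∞)`, so the
difference is the integral over `(0, t]`. -/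
theorem HasDecay.exists_isGeneratorInverse [CompleteSpace X] [IsScalarTower ℝ 𝕜 X]
    (h : T.HasDecay M ω) :
    ∃ R : X →L[𝕜] X, T.IsGeneratorInverse R := by
  have hsm : ∀ (c : 𝕜) (x : X), (∫ s in Ioi (0 : ℝ), c • T.realMap s x) =
      c • ∫ s in Ioi (0 : ℝ), T.realMap s x := fun c x => integral_smul c _
  let L : X →ₗ[𝕜] X :=
    { toFun := fun x => -∫ s in Ioi (0 : ℝ), T.realMap s x
      map_add' := fun x y => by
        simp only [map_add]
        rw [integral_add (h.integrableOn x) (h.integrableOn y), neg_add]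
      map_smul' := fun c x => by
        simp only [map_smul]
        rw [hsm, RingHom.id_apply, smul_neg] }
  have hL : ∀ x, L x = -∫ s in Ioi (0 : ℝ), T.realMap s x := fun _ => rfl
  have hb : ∀ x, ‖L x‖ ≤ (∫ s in Ioi (0 : ℝ), M * Real.exp (-ω * s)) * ‖x‖ := fun x => by
    rw [hL, norm_neg, ← integral_mul_const]
    refine norm_integral_le_of_norm_le
      (((integrableOn_exp_mul_Ioi (by linarith [h.rate_pos]) 0).const_mul M).mul_const _) ?_
    filter_upwards [ae_restrict_mem measurableSet_Ioi] with s hs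
    exact h.norm_realMap_le (le_of_lt hs) x
  refine ⟨L.mkContinuous _ hb, fun t x => ?_, fun t ht x => ?_⟩
  · rw [LinearMap.mkContinuous_apply, LinearMap.mkContinuous_apply, hL, hL, map_neg,
      ← ContinuousLinearMap.integral_comp_comm _ (h.integrableOn x)]
    congr 2
    funext s
    rw [realMap, ← ContinuousLinearMap.comp_apply, ← ContinuousLinearMap.comp_apply, ← T.apply_add,
      ← T.apply_add, add_comm]
  · rw [LinearMap.mkContinuous_apply, map_sub, hL, hL]
    have h1 : ∫ s in Ioi (0 : ℝ), T.realMap s (T.realMap t x) =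
        ∫ s in Ioi t, T.realMap s x := by
      have := (measurePreserving_add_right volume t).setIntegral_preimage_emb
        (measurableEmbedding_addRight t) (fun s => T.realMap s x) (Ioi t)
      rw [← this, show (fun s => s + t) ⁻¹' Ioi t = Ioi 0 by ext; simp]
      refine setIntegral_congr_fun measurableSet_Ioi fun s hs => ?_
      exact (T.realMap_add (le_of_lt hs) ht x).symm
    rw [h1, ← intervalIntegral.integral_Ioi_sub_Ioi (h.integrableOn x) ht]
    abel

variable {R : X →L[𝕜] X}

theorem IsGeneratorInverse.comm_realMap (hR : T.IsGeneratorInverse R) (t : ℝ) (x : X) :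
    T.realMap t (R x) = R (T.realMap t x) := hR.comm _ x

theorem diffQuot_comp_eq [IsScalarTower ℝ 𝕜 X] (x : X) (t : ℝ≥0) :
    T.diffQuot x t = (t : ℝ)⁻¹ • (T.realMap t x - x) := by
  rw [diffQuot, realMap, Real.toNNReal_coe, ← RCLike.ofReal_inv, RCLike.real_smul_eq_coe_smul (K := 𝕜)]

/-- `R` turns the difference quotient into the mean of the orbit over `[0, t]`, which tends to its
value at `0`. All relations between `R` and `A` come from this limit. -/
theorem IsGeneratorInverse.tendsto_map_diffQuot [CompleteSpace X] [IsScalarTower ℝ 𝕜 X]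
    (h : T.HasDecay M ω)
    (hR : T.IsGeneratorInverse R) (x : X) :
    Tendsto (fun t => R (T.diffQuot x t)) (𝓝[>] 0) (𝓝 x) := by
  have hd : HasDerivAt (fun t => ∫ s in (0 : ℝ)..t, T.realMap s x) x 0 := by
    have := (h.continuous_realMap x).integral_hasStrictDerivAt 0 0
    rw [realMap_zero] at this
    exact this.hasDerivAt
  have hs := hd.tendsto_slope_zero_right
  have hc : Tendsto (fun t : ℝ≥0 => (t : ℝ)) (𝓝[>] 0) (𝓝[>] 0) := by
    refine tendsto_nhdsWithin_of_tendsto_nhds_of_eventually_within _ ?_ ?_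
    · exact (NNReal.continuous_coe.tendsto 0).mono_left nhdsWithin_le_nhds
    · filter_upwards [self_mem_nhdsWithin] with t ht
      exact NNReal.coe_pos.2 ht
  refine (hs.comp hc).congr fun t => ?_
  simp only [Function.comp, zero_add, intervalIntegral.integral_same, sub_zero]
  rw [← hR.eq_integral t t.2, diffQuot_comp_eq, RCLike.real_smul_eq_coe_smul (K := 𝕜),
    RCLike.real_smul_eq_coe_smul (K := 𝕜), map_smul]

theorem IsGeneratorInverse.tendsto_diffQuot_map [CompleteSpace X] [IsScalarTower ℝ 𝕜 X]
    (h : T.HasDecay M ω)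
    (hR : T.IsGeneratorInverse R) (x : X) : Tendsto (T.diffQuot (R x)) (𝓝[>] 0) (𝓝 x) := by
  refine (hR.tendsto_map_diffQuot h x).congr fun t => ?_
  simp only [diffQuot, map_smul, map_sub, hR.comm]

/-- For `y ∈ D(A)`, `R` of the difference quotients tends both to `y` and to `R (A y)`. -/
theorem IsGeneratorInverse.mem_graph_iff [CompleteSpace X] [IsScalarTower ℝ 𝕜 X]
    (h : T.HasDecay M ω)
    (hR : T.IsGeneratorInverse R) (a b : X) : (a, b) ∈ T.generator.graph ↔ a = R b := by
  rw [LinearPMap.mem_graph_iff]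
  constructor
  · rintro ⟨y, rfl, rfl⟩
    exact tendsto_nhds_unique (hR.tendsto_map_diffQuot h y)
      ((R.continuous.tendsto _).comp (T.generator_tendsto y))
  · rintro rfl
    have := hR.tendsto_diffQuot_map h b
    exact ⟨⟨R b, b, this⟩, rfl, tendsto_nhds_unique (T.generator_tendsto _) this⟩

theorem IsGeneratorInverse.injective [CompleteSpace X] [IsScalarTower ℝ 𝕜 X]
    (h : T.HasDecay M ω)
    (hR : T.IsGeneratorInverse R) : Function.Injective R := by
  rw [injective_iff_map_eq_zero]
  intro b hb
  have := hR.tendsto_diffQuot_map h b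
  rw [hb] at this
  refine tendsto_nhds_unique this (tendsto_const_nhds.congr fun t => ?_)
  simp [diffQuot]

theorem IsGeneratorInverse.dense_domain [CompleteSpace X] [IsScalarTower ℝ 𝕜 X]
    (h : T.HasDecay M ω)
    (hR : T.IsGeneratorInverse R) : Dense (T.generator.domain : Set X) := by
  intro x
  refine mem_closure_of_tendsto (hR.tendsto_map_diffQuot h x) (Eventually.of_forall fun t => ?_)
  exact ⟨_, hR.tendsto_diffQuot_map h _⟩

end

/-! ### The extrapolation space as a copy of `X`. -/

section

variable {𝕜 X : Type*} [RCLike 𝕜] [NormedAddCommGroup X] [InnerProductSpace 𝕜 X]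
  [CompleteSpace X] {T : C0Semigroup 𝕜 X} {M ω : ℝ} {R : X →L[𝕜] X}

theorem genExt_apply (T : C0Semigroup 𝕜 X) (x : X) (p : T.AdjDomain) :
    T.genExt x p = inner 𝕜 (AdjDomain.incl T p).2 x := rfl

theorem embed_apply (T : C0Semigroup 𝕜 X) (x : X) (p : T.AdjDomain) :
    T.embed x p = inner 𝕜 (AdjDomain.incl T p).1 x := rfl

theorem ext_apply (T : C0Semigroup 𝕜 X) (s : ℝ≥0) (f : T.Xneg) (p : T.AdjDomain) :
    T.ext s f p = f (T.adjMap s p) := rfl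

theorem incl_adjMap_snd (T : C0Semigroup 𝕜 X) (s : ℝ≥0) (p : T.AdjDomain) :
    (AdjDomain.incl T (T.adjMap s p)).2 = (T.toFun s).adjoint (AdjDomain.incl T p).2 := rfl

theorem ext_genExt (T : C0Semigroup 𝕜 X) (s : ℝ≥0) (x : X) :
    T.ext s (T.genExt x) = T.genExt (T.toFun s x) := by
  refine ContinuousLinearMap.ext fun p => ?_
  rw [ext_apply, genExt_apply, genExt_apply, incl_adjMap_snd,
    ContinuousLinearMap.adjoint_inner_left]

variable [NormedSpace ℝ X] [IsScalarTower ℝ 𝕜 X]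

theorem IsGeneratorInverse.mem_adjoint_graph_iff (h : T.HasDecay M ω)
    (hR : T.IsGeneratorInverse R) (p : X × X) :
    p ∈ T.generator†.graph ↔ p.1 = R.adjoint p.2 := by
  rw [LinearPMap.adjoint_graph_eq_graph_adjoint (hR.dense_domain h), Submodule.mem_adjoint_iff]
  constructor
  · intro H
    refine ext_inner_left 𝕜 fun b => ?_
    rw [ContinuousLinearMap.adjoint_inner_right]
    exact sub_eq_zero.1 (H (R b) b ((hR.mem_graph_iff h _ _).2 rfl))
  · rintro H a b hab
    rw [(hR.mem_graph_iff h _ _).1 hab, H, ContinuousLinearMap.adjoint_inner_right, sub_self]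

theorem IsGeneratorInverse.incl_fst (h : T.HasDecay M ω) (hR : T.IsGeneratorInverse R)
    (p : T.AdjDomain) : (AdjDomain.incl T p).1 = R.adjoint (AdjDomain.incl T p).2 :=
  (hR.mem_adjoint_graph_iff h _).1 p.2

/-- This identity is what moves the whole problem from `X₋₁` to `X`: membership in `X` becomes
membership in the range of `R`. -/
theorem IsGeneratorInverse.embed_eq (h : T.HasDecay M ω) (hR : T.IsGeneratorInverse R) (x : X) :
    T.embed x = T.genExt (R x) := by
  refine ContinuousLinearMap.ext fun p => ?_
  rw [embed_apply, genExt_apply, hR.incl_fst h, ContinuousLinearMap.adjoint_inner_left]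

/-- The element `(R* ψ, ψ)` of the graph of `A*`. -/
noncomputable def IsGeneratorInverse.adjLift (h : T.HasDecay M ω) (hR : T.IsGeneratorInverse R) :
    X →L[𝕜] T.AdjDomain :=
  (R.adjoint.prod (ContinuousLinearMap.id 𝕜 X)).codRestrict T.generator†.graph
    fun _ => (hR.mem_adjoint_graph_iff h _).2 rfl

theorem IsGeneratorInverse.incl_adjLift_snd (h : T.HasDecay M ω) (hR : T.IsGeneratorInverse R)
    (ψ : X) : (AdjDomain.incl T (hR.adjLift h ψ)).2 = ψ := rfl

theorem IsGeneratorInverse.adjLift_incl_snd (h : T.HasDecay M ω) (hR : T.IsGeneratorInverse R)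
    (p : T.AdjDomain) : hR.adjLift h (AdjDomain.incl T p).2 = p :=
  Subtype.ext (Prod.ext (hR.incl_fst h p).symm rfl)

/-- The graph of `A*` is parametrized by its second component `ψ`, so functionals on it are
functionals on `X`, represented by Riesz. -/
theorem IsGeneratorInverse.genExt_bijective (h : T.HasDecay M ω) (hR : T.IsGeneratorInverse R) :
    Function.Bijective T.genExt := by
  refine ⟨(injective_iff_map_eq_zero _).2 fun x hx => ?_, fun f => ?_⟩
  · refine ext_inner_left 𝕜 fun ψ => ?_
    rw [← hR.incl_adjLift_snd h ψ, ← genExt_apply, hx, inner_zero_right]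
    rfl
  -- Riesz is stated for linear functionals, whereas `f` is conjugate-linear; hence the conjugation.
  · let g : StrongDual 𝕜 X :=
      ((starL 𝕜 : 𝕜 ≃L⋆[𝕜] 𝕜) : 𝕜 →L⋆[𝕜] 𝕜).comp (f.comp (hR.adjLift h))
    refine ⟨(InnerProductSpace.toDual 𝕜 X).symm g, ContinuousLinearMap.ext fun p => ?_⟩
    rw [genExt_apply, ← inner_conj_symm, InnerProductSpace.toDual_symm_apply]
    change star (star (f (hR.adjLift h (AdjDomain.incl T p).2))) = f p
    rw [star_star, hR.adjLift_incl_snd]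

/-- The extended generator as an isomorphism of `X` onto `X₋₁`. -/
noncomputable def IsGeneratorInverse.genEquiv (h : T.HasDecay M ω) (hR : T.IsGeneratorInverse R) :
    X ≃L[𝕜] T.Xneg :=
  ContinuousLinearEquiv.ofBijective T.genExt
    (LinearMap.ker_eq_bot.2 (hR.genExt_bijective h).1)
    (LinearMap.range_eq_top.2 (hR.genExt_bijective h).2)

theorem IsGeneratorInverse.genEquiv_apply (h : T.HasDecay M ω) (hR : T.IsGeneratorInverse R)
    (x : X) : hR.genEquiv h x = T.genExt x := rfl

/-- No integrability is needed: as `genExt` is an isomorphism, both sides take the default value `0`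
together. -/
theorem IsGeneratorInverse.intervalIntegral_genExt (h : T.HasDecay M ω)
    (hR : T.IsGeneratorInverse R) (f : ℝ → X) (a b : ℝ) :
    ∫ s in a..b, T.genExt (f s) = T.genExt (∫ s in a..b, f s) := by
  simp only [intervalIntegral, map_sub, ← hR.genEquiv_apply h,
    ContinuousLinearEquiv.integral_comp_comm]

theorem IsGeneratorInverse.inputMap_eq {U : Type*} [NormedAddCommGroup U] [InnerProductSpace 𝕜 U]
    (h : T.HasDecay M ω) (hR : T.IsGeneratorInverse R) (b : U →L[𝕜] X) (τ : ℝ) (u : ℝ → U) :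
    T.inputMap (T.genExt.comp b) τ u =
      T.genExt (∫ σ in (0 : ℝ)..τ, T.realMap (τ - σ) (b (u σ))) := by
  rw [← hR.intervalIntegral_genExt h, inputMap]
  simp only [ContinuousLinearMap.comp_apply, ext_genExt]

theorem IsGeneratorInverse.isSolution_iff (h : T.HasDecay M ω) (hR : T.IsGeneratorInverse R)
    (v x : ℝ → X) :
    T.IsSolution (fun t => T.genExt (v t)) x ↔
      LocallyIntegrableOn x (Ici 0) ∧ ContinuousOn (fun t => R (x t)) (Ici 0) ∧
        ∀ t ≥ 0, R (x t) - R (x 0) = ∫ σ in (0 : ℝ)..t, (x σ + v σ) := by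
  have hc : ContinuousOn (fun t => T.embed (x t)) (Ici 0) ↔
      ContinuousOn (fun t => R (x t)) (Ici 0) := by
    simp only [hR.embed_eq h, ← hR.genEquiv_apply h]
    exact (hR.genEquiv h).comp_continuousOn_iff
  have he : ∀ t, (T.embed (x t) - T.embed (x 0) =
      ∫ σ in (0 : ℝ)..t, (T.genExt (x σ) + T.genExt (v σ))) ↔
      R (x t) - R (x 0) = ∫ σ in (0 : ℝ)..t, (x σ + v σ) := fun t => by
    simp only [hR.embed_eq h, ← map_add, ← map_sub, hR.intervalIntegral_genExt h]
    exact (hR.genExt_bijective h).1.eq_iff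
  exact ⟨fun H => ⟨H.1, hc.1 H.2, fun t ht => (he t).1 (H.3 t ht)⟩,
    fun H => ⟨H.1, hc.2 H.2.1, fun t ht => (he t).2 (H.2.2 t ht)⟩⟩

end

end C0Semigroup

/-! ### Convolution with the semigroup, and uniqueness. -/

/-- Fubini's theorem on a triangle. -/
theorem intervalIntegral_triangle_swap {X : Type*} [NormedAddCommGroup X] [NormedSpace ℝ X]
    {f : ℝ → ℝ → X} {t : ℝ} (ht : 0 ≤ t)
    (hf : Integrable (Function.uncurry f)
      ((volume.restrict (Ioc 0 t)).prod (volume.restrict (Ioc 0 t)))) :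
    ∫ σ in (0 : ℝ)..t, ∫ r in (0 : ℝ)..σ, f σ r = ∫ r in (0 : ℝ)..t, ∫ σ in r..t, f σ r := by
  -- Both sides are iterated integrals over the square of `f` times the indicator of `r ≤ σ`.
  have hm : MeasurableSet {p : ℝ × ℝ | p.2 ≤ p.1} :=
    measurableSet_le measurable_snd measurable_fst
  have hsw := integral_integral_swap (f := fun σ r =>
    {p : ℝ × ℝ | p.2 ≤ p.1}.indicator (Function.uncurry f) (σ, r)) (hf.indicator hm)
  rw [intervalIntegral.integral_of_le ht, intervalIntegral.integral_of_le ht]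
  have h1 : ∀ σ ∈ Ioc 0 t, ∫ r in (0 : ℝ)..σ, f σ r = ∫ r in Ioc 0 t,
      {p : ℝ × ℝ | p.2 ≤ p.1}.indicator (Function.uncurry f) (σ, r) := fun σ hσ => by
    have : ∀ r, {p : ℝ × ℝ | p.2 ≤ p.1}.indicator (Function.uncurry f) (σ, r) =
        (Iic σ).indicator (f σ) r := fun r => by
      simp only [indicator, mem_ofPred_eq, mem_Iic, Function.uncurry]
    simp only [this]
    rw [setIntegral_indicator measurableSet_Iic, intervalIntegral.integral_of_le hσ.1.le]
    congr 2
    ext r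
    simp only [mem_Ioc, mem_inter_iff, mem_Iic]
    exact ⟨fun hr => ⟨⟨hr.1, hr.2.trans hσ.2⟩, hr.2⟩, fun hr => ⟨hr.1.1, hr.2⟩⟩
  have h2 : ∀ r ∈ Ioc 0 t, ∫ σ in r..t, f σ r = ∫ σ in Ioc 0 t,
      {p : ℝ × ℝ | p.2 ≤ p.1}.indicator (Function.uncurry f) (σ, r) := fun r hr => by
    have : ∀ σ, {p : ℝ × ℝ | p.2 ≤ p.1}.indicator (Function.uncurry f) (σ, r) =
        (Ici r).indicator (fun σ => f σ r) σ := fun r => by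
      simp only [indicator, mem_ofPred_eq, mem_Ici, Function.uncurry]
    simp only [this]
    -- The section of the triangle contains its left endpoint `r`, hence the change from `Ioc` to
    -- `Icc`.
    rw [setIntegral_indicator measurableSet_Ici, intervalIntegral.integral_of_le hr.2,
      ← integral_Icc_eq_integral_Ioc]
    congr 2
    ext σ
    simp only [mem_Ioc, mem_Icc, mem_inter_iff, mem_Ici]
    exact ⟨fun hσ => ⟨⟨hr.1.trans_le hσ.1, hσ.2⟩, hσ.1⟩, fun hσ => ⟨hσ.2, hσ.1.2⟩⟩
  rw [setIntegral_congr_fun measurableSet_Ioc h1, setIntegral_congr_fun measurableSet_Ioc h2]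
  exact hsw

namespace C0Semigroup

section

variable {𝕜 X : Type*} [RCLike 𝕜] [NormedAddCommGroup X] [InnerProductSpace 𝕜 X]
  {T : C0Semigroup 𝕜 X} {M ω : ℝ} {R : X →L[𝕜] X}

theorem HasDecay.aestronglyMeasurable_realMap (h : T.HasDecay M ω) {α : Type*} [MeasurableSpace α]
    {μ : Measure α} {g : α → ℝ} {v : α → X} (hg : AEStronglyMeasurable g μ)
    (hv : AEStronglyMeasurable v μ) :
    AEStronglyMeasurable (fun a => T.realMap (g a) (v a)) μ :=
  h.continuous_realMap_apply.comp_aestronglyMeasurable (hg.prodMk hv)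

theorem HasDecay.integrable_realMap (h : T.HasDecay M ω) {α : Type*} [MeasurableSpace α]
    {μ : Measure α} {g : α → ℝ} {v : α → X} (hg : AEStronglyMeasurable g μ)
    (hv : Integrable v μ) : Integrable (fun a => T.realMap (g a) (v a)) μ :=
  (hv.norm.const_mul M).mono' (h.aestronglyMeasurable_realMap hg hv.1)
    (Eventually.of_forall fun _ => h.norm_toFun_le _ _)

theorem HasDecay.intervalIntegrable_realMap (h : T.HasDecay M ω) {a b : ℝ}
    {g : ℝ → ℝ} {v : ℝ → X} (hg : Continuous g)
    (hv : IntervalIntegrable v volume a b) :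
    IntervalIntegrable (fun a => T.realMap (g a) (v a)) volume a b :=
  ⟨h.integrable_realMap hg.aestronglyMeasurable hv.1,
    h.integrable_realMap hg.aestronglyMeasurable hv.2⟩

variable [NormedSpace ℝ X]

/-- The mild solution `∫₀ᵗ T(t - r) v(r) dr` with forcing `v` and zero initial value. -/
noncomputable def mild (T : C0Semigroup 𝕜 X) (v : ℝ → X) (t : ℝ) : X :=
  ∫ r in (0 : ℝ)..t, T.realMap (t - r) (v r)

theorem HasDecay.triangle_swap (h : T.HasDecay M ω) {v : ℝ → X} {t : ℝ} (ht : 0 ≤ t)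
    (hv : IntervalIntegrable v volume 0 t) {g : ℝ → ℝ → ℝ} (hg : Continuous (Function.uncurry g)) :
    ∫ σ in (0 : ℝ)..t, ∫ r in (0 : ℝ)..σ, T.realMap (g σ r) (v r) =
      ∫ r in (0 : ℝ)..t, ∫ σ in r..t, T.realMap (g σ r) (v r) := by
  refine intervalIntegral_triangle_swap ht ?_
  have h1 : Integrable v (volume.restrict (Ioc 0 t)) :=
    (intervalIntegrable_iff_integrableOn_Ioc_of_le ht).1 hv
  exact h.integrable_realMap hg.aestronglyMeasurable (h1.comp_snd _)

variable [CompleteSpace X]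

/-- The common value of the next two integrals: after Fubini, the inner one is over `s = σ - r` in
the first and `s = t - σ` in the second. -/
theorem IsGeneratorInverse.integral_terminal (h : T.HasDecay M ω) (hR : T.IsGeneratorInverse R)
    {v : ℝ → X} {t : ℝ} (ht : 0 ≤ t) (hv : IntervalIntegrable v volume 0 t) :
    ∫ r in (0 : ℝ)..t, (∫ s in (0 : ℝ)..(t - r), T.realMap s (v r)) =
      R (T.mild v t) - R (∫ r in (0 : ℝ)..t, v r) := by
  have hi : IntervalIntegrable (fun r => T.realMap (t - r) (v r)) volume 0 t :=
    h.intervalIntegrable_realMap (by fun_prop) hv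
  rw [mild, ← map_sub, ← intervalIntegral.integral_sub hi hv,
    ← ContinuousLinearMap.intervalIntegral_comp_comm _ (hi.sub hv)]
  refine intervalIntegral.integral_congr fun r hr => ?_
  rw [uIcc_of_le ht] at hr
  exact (hR.eq_integral _ (by linarith [hr.2]) _).symm

theorem IsGeneratorInverse.integral_mild (h : T.HasDecay M ω) (hR : T.IsGeneratorInverse R)
    {v : ℝ → X} {t : ℝ} (ht : 0 ≤ t) (hv : IntervalIntegrable v volume 0 t) :
    ∫ σ in (0 : ℝ)..t, T.mild v σ = R (T.mild v t) - R (∫ r in (0 : ℝ)..t, v r) := by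
  rw [← hR.integral_terminal h ht hv]
  simp only [mild]
  rw [h.triangle_swap ht hv (g := fun σ r => σ - r) (by fun_prop)]
  refine intervalIntegral.integral_congr fun r _ => ?_
  have := intervalIntegral.integral_comp_sub_right (a := r) (b := t)
    (fun s => T.realMap s (v r)) r
  simpa using this

theorem IsGeneratorInverse.mild_integral [IsScalarTower ℝ 𝕜 X]
    (h : T.HasDecay M ω) (hR : T.IsGeneratorInverse R)
    {v : ℝ → X} {t : ℝ} (ht : 0 ≤ t) (hv : IntervalIntegrable v volume 0 t) :
    T.mild (fun σ => ∫ r in (0 : ℝ)..σ, v r) t =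
      R (T.mild v t) - R (∫ r in (0 : ℝ)..t, v r) := by
  rw [← hR.integral_terminal h ht hv]
  have h1 : T.mild (fun σ => ∫ r in (0 : ℝ)..σ, v r) t =
      ∫ σ in (0 : ℝ)..t, ∫ r in (0 : ℝ)..σ, T.realMap (t - σ) (v r) := by
    refine intervalIntegral.integral_congr fun σ hσ => ?_
    rw [uIcc_of_le ht] at hσ
    refine (ContinuousLinearMap.intervalIntegral_comp_comm _ ?_).symm
    exact hv.mono_set (by rw [uIcc_of_le hσ.1, uIcc_of_le ht]; exact Icc_subset_Icc_right hσ.2)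
  rw [h1, h.triangle_swap ht hv (g := fun σ r => t - σ) (by fun_prop)]
  refine intervalIntegral.integral_congr fun r _ => ?_
  have := intervalIntegral.integral_comp_sub_left (a := r) (b := t)
    (fun s => T.realMap s (v r)) t
  simpa using this

theorem intervalIntegrable_of_locallyIntegrableOn {E : Type*} [NormedAddCommGroup E] {f : ℝ → E}
    (hf : LocallyIntegrableOn f (Ici 0)) {t : ℝ} (ht : 0 ≤ t) :
    IntervalIntegrable f volume 0 t := by
  rw [intervalIntegrable_iff_integrableOn_Icc_of_le ht]
  exact hf.integrableOn_compact_subset Icc_subset_Ici_self isCompact_Icc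

variable [IsScalarTower ℝ 𝕜 X]

/-- Since `∫ d = R d`, the left side of `mild_integral` is `R (mild d)`. The remaining term `R (∫₀ᵗ
d) = R (R (d t))` must vanish, and `R` is injective. -/
theorem IsGeneratorInverse.eq_zero_of_eq_integral (h : T.HasDecay M ω)
    (hR : T.IsGeneratorInverse R) {d : ℝ → X} (hd : LocallyIntegrableOn d (Ici 0))
    (he : ∀ t ≥ 0, R (d t) = ∫ σ in (0 : ℝ)..t, d σ) {t : ℝ} (ht : 0 ≤ t) : d t = 0 := by
  have hi := intervalIntegrable_of_locallyIntegrableOn hd ht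
  have h1 := hR.mild_integral h ht hi
  have h2 : T.mild (fun σ => ∫ r in (0 : ℝ)..σ, d r) t = R (T.mild d t) := by
    rw [mild, mild, ← ContinuousLinearMap.intervalIntegral_comp_comm _
      (h.intervalIntegrable_realMap (by fun_prop) hi)]
    refine intervalIntegral.integral_congr fun σ hσ => ?_
    rw [uIcc_of_le ht] at hσ
    rw [← he σ hσ.1, hR.comm_realMap]
  rw [h2, ← he t ht, eq_comm, sub_eq_self] at h1
  exact (injective_iff_map_eq_zero R).1 (hR.injective h) _
    ((injective_iff_map_eq_zero R).1 (hR.injective h) _ h1)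

theorem IsGeneratorInverse.mild_solution (h : T.HasDecay M ω) (hR : T.IsGeneratorInverse R)
    {v y : ℝ → X} (x₀ : X) (hy : ContinuousOn y (Ici 0))
    (hyv : ∀ t ≥ 0, R (y t) = T.mild v t) {t : ℝ} (ht : 0 ≤ t)
    (hv : IntervalIntegrable v volume 0 t) :
    R (T.realMap t x₀ + y t) - R x₀ =
      ∫ σ in (0 : ℝ)..t, (T.realMap σ x₀ + y σ + v σ) := by
  -- The hypothesis determines `R (y σ)` rather than `y σ`, so the equation is checked after one
  -- more application of `R`.
  apply hR.injective h
  have hT : IntervalIntegrable (fun σ => T.realMap σ x₀) volume 0 t :=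
    (h.continuous_realMap x₀).intervalIntegrable _ _
  have hyi : IntervalIntegrable y volume 0 t :=
    intervalIntegrable_of_locallyIntegrableOn (hy.locallyIntegrableOn measurableSet_Ici) ht
  rw [intervalIntegral.integral_add (hT.add hyi) hv, intervalIntegral.integral_add hT hyi,
    ← hR.eq_integral t ht, map_add R (_ + _), map_add R (R _),
    ← ContinuousLinearMap.intervalIntegral_comp_comm R hyi]
  have : ∫ σ in (0 : ℝ)..t, R (y σ) = ∫ σ in (0 : ℝ)..t, T.mild v σ := by
    refine intervalIntegral.integral_congr fun σ hσ => ?_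
    rw [uIcc_of_le ht] at hσ
    exact hyv σ hσ.1
  rw [this, hR.integral_mild h ht hv, map_add R, ← hyv t ht]
  simp only [map_add, map_sub]
  abel

end

end C0Semigroup

/-! ### The input operator and continuity of the state. -/

/-- A bounded operator whose range lies in the range of an injective bounded operator factors
through it continuously. -/
theorem ContinuousLinearMap.exists_factor_of_range_subset {𝕜 E F G : Type*}
    [NontriviallyNormedField 𝕜]
    [NormedAddCommGroup E] [NormedSpace 𝕜 E] [CompleteSpace E]
    [NormedAddCommGroup F] [NormedSpace 𝕜 F] [CompleteSpace F]
    [NormedAddCommGroup G] [NormedSpace 𝕜 G]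
    (W : E →L[𝕜] G) (R : F →L[𝕜] G) (hR : Function.Injective R) (hW : ∀ f, ∃ x, R x = W f) :
    ∃ Φ : E →L[𝕜] F, ∀ f, R (Φ f) = W f := by
  choose g hg using hW
  let L : E →ₗ[𝕜] F :=
    { toFun := g
      map_add' := fun a b => hR (by rw [map_add, hg, hg, hg, map_add])
      map_smul' := fun c a => hR (by rw [map_smul, hg, hg, map_smul, RingHom.id_apply]) }
  -- The graph is closed: `R (g (u n)) = W (u n)` tends both to `R y` and to `W x = R (g x)`.
  refine ⟨⟨L, L.continuous_of_seq_closed_graph fun u x y hu hy => hR ?_⟩, hg⟩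
  have h1 : Tendsto (fun n => R (g (u n))) atTop (𝓝 (R y)) := (R.continuous.tendsto y).comp hy
  have h2 : Tendsto (fun n => R (g (u n))) atTop (𝓝 (W x)) := by
    simp only [hg]
    exact (W.continuous.tendsto x).comp hu
  exact (tendsto_nhds_unique h1 h2).trans (hg x).symm

namespace C0Semigroup

section

variable {𝕜 X : Type*} [RCLike 𝕜] [NormedAddCommGroup X] [InnerProductSpace 𝕜 X]
  {T : C0Semigroup 𝕜 X} {M ω : ℝ} {R : X →L[𝕜] X}
  {U : Type*} [NormedAddCommGroup U] [NormedSpace 𝕜 U]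

/-- The state at time `0` reached by applying the input `f` on `[-L, 0]`, as seen through the
extended generator. -/
noncomputable def history [NormedSpace ℝ X] (T : C0Semigroup 𝕜 X) (b : U →L[𝕜] X) (L : ℝ) (f : ℝ → U) : X :=
  ∫ s in (0 : ℝ)..L, T.realMap s (b (f (-s)))

theorem HasDecay.intervalIntegrable_history (h : T.HasDecay M ω) (b : U →L[𝕜] X) (a L : ℝ)
    {f : ℝ → U} (hf : MemLp f 2 volume) :
    IntervalIntegrable (fun s => T.realMap s (b (f (-s)))) volume a L := by
  refine h.intervalIntegrable_realMap continuous_id ?_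
  have h1 : MemLp (fun s => f (-s)) 2 volume :=
    hf.comp_measurePreserving (Measure.measurePreserving_neg volume)
  exact ⟨b.integrable_comp ((h1.restrict _).integrable one_le_two),
    b.integrable_comp ((h1.restrict _).integrable one_le_two)⟩

variable [NormedSpace ℝ X]

theorem history_congr (b : U →L[𝕜] X) (L : ℝ) {f g : ℝ → U} (hfg : f =ᵐ[volume] g) :
    T.history b L f = T.history b L g := by
  refine intervalIntegral.integral_congr_ae' ?_ ?_ <;>
  · filter_upwards [(Measure.measurePreserving_neg volume).quasiMeasurePreserving.ae_eq_comp hfg]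
      with s hs _
    simp only [Function.comp] at hs
    rw [hs]

/-- Cauchy–Schwarz gives the factor `√L`. This bounds only `R` of the state; the bound on the state
itself needs the closed graph theorem. -/
theorem HasDecay.norm_history_le (h : T.HasDecay M ω) (b : U →L[𝕜] X) {L : ℝ} (hL : 0 ≤ L)
    {f : ℝ → U} (hf : MemLp f 2 volume) :
    ‖T.history b L f‖ ≤
      M * ‖b‖ * (ENNReal.ofReal L ^ (1 / 2 : ℝ)).toReal * (eLpNorm f 2 volume).toReal := by
  have h1 : MemLp (fun s => f (-s)) 2 volume :=
    hf.comp_measurePreserving (Measure.measurePreserving_neg volume)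
  have h2 : Integrable (fun s => f (-s)) (volume.restrict (Ioc 0 L)) :=
    (h1.restrict _).integrable one_le_two
  have h3 : eLpNorm (fun s => f (-s)) 1 (volume.restrict (Ioc 0 L)) ≤
      eLpNorm f 2 volume * ENNReal.ofReal L ^ (1 / 2 : ℝ) := by
    refine (eLpNorm_le_eLpNorm_mul_rpow_measure_univ one_le_two h2.1).trans ?_
    rw [Measure.restrict_apply_univ, Real.volume_Ioc, sub_zero]
    have h4 : eLpNorm (fun s => f (-s)) 2 volume = eLpNorm f 2 volume :=
      eLpNorm_comp_measurePreserving hf.1 (Measure.measurePreserving_neg volume)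
    have h5 : (1 / (1 : ℝ≥0∞).toReal - 1 / (2 : ℝ≥0∞).toReal : ℝ) = 1 / 2 := by norm_num
    rw [h5, ← h4]
    gcongr
    exact Measure.restrict_le_self
  have h6 : ∫ s in Ioc 0 L, ‖f (-s)‖ ≤
      (ENNReal.ofReal L ^ (1 / 2 : ℝ)).toReal * (eLpNorm f 2 volume).toReal := by
    rw [integral_norm_eq_lintegral_enorm h2.1, ← eLpNorm_one_eq_lintegral_enorm, mul_comm,
      ← ENNReal.toReal_mul]
    refine ENNReal.toReal_mono (ENNReal.mul_ne_top hf.2.ne ?_) h3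
    exact ENNReal.rpow_ne_top_of_nonneg (by norm_num) ENNReal.ofReal_ne_top
  rw [history, intervalIntegral.integral_of_le hL, mul_assoc]
  calc _ ≤ ∫ s in Ioc 0 L, M * ‖b‖ * ‖f (-s)‖ := by
        refine norm_integral_le_of_norm_le (h2.norm.const_mul _) (Eventually.of_forall fun s => ?_)
        refine (h.norm_toFun_le _ _).trans ?_
        rw [mul_assoc]
        exact mul_le_mul_of_nonneg_left (b.le_opNorm _) h.pos.le
    _ = M * ‖b‖ * ∫ s in Ioc 0 L, ‖f (-s)‖ := integral_const_mul _ _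
    _ ≤ _ := mul_le_mul_of_nonneg_left h6 (by have := h.pos; positivity)

/-- The input older than `τ` produces a state at time `-τ`, which `T_τ` carries to time `0`. -/
theorem HasDecay.history_add_time [CompleteSpace X] (h : T.HasDecay M ω) (b : U →L[𝕜] X)
    {τ τ' : ℝ} (hτ : 0 ≤ τ) (hτ' : 0 ≤ τ') {f : ℝ → U} (hf : MemLp f 2 volume) :
    T.history b (τ + τ') f =
      T.history b τ f + T.realMap τ (T.history b τ' (fun x => f (x - τ))) := by
  have hf' : MemLp (fun x => f (x - τ)) 2 volume :=
    hf.comp_measurePreserving (measurePreserving_sub_right volume τ)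
  rw [history, ← intervalIntegral.integral_add_adjacent_intervals
    (h.intervalIntegrable_history b 0 τ hf) (h.intervalIntegrable_history b τ (τ + τ') hf)]
  refine congrArg₂ (· + ·) rfl ?_
  rw [history, ← ContinuousLinearMap.intervalIntegral_comp_comm _
    (h.intervalIntegrable_history b 0 τ' hf')]
  have := intervalIntegral.integral_comp_add_left (a := 0) (b := τ')
    (fun s => T.realMap s (b (f (-s)))) τ
  rw [add_zero] at this
  rw [← this]
  refine intervalIntegral.integral_congr fun s hs => ?_
  rw [uIcc_of_le hτ'] at hs
  rw [T.realMap_add hτ hs.1, neg_add']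
  congr 4
  ring

theorem exists_eq_history {b : U →L[𝕜] X} {τ : ℝ}
    (hA : ∀ u : ℝ → U, MemLp u 2 (volume.restrict (Ici 0)) →
      ∃ x, R x = T.mild (fun s => b (u s)) τ)
    {f : ℝ → U} (hf : MemLp f 2 volume) : ∃ x, R x = T.history b τ f := by
  have hf' : MemLp (fun x => f (x - τ)) 2 volume :=
    hf.comp_measurePreserving (measurePreserving_sub_right volume τ)
  obtain ⟨x, hx⟩ := hA _ (hf'.restrict _)
  refine ⟨x, hx.trans ?_⟩
  have := intervalIntegral.integral_comp_sub_left (a := 0) (b := τ)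
    (fun s => T.realMap s (b (f (-s)))) τ
  simpa [history, mild] using this

/-- Admissibility at one time passes to all its multiples, because the range of `R` is invariant
under the semigroup. -/
theorem IsGeneratorInverse.exists_eq_history_mul [CompleteSpace X] (h : T.HasDecay M ω)
    (hR : T.IsGeneratorInverse R) {b : U →L[𝕜] X} {τ : ℝ} (hτ : 0 ≤ τ)
    (hA : ∀ f : ℝ → U, MemLp f 2 volume → ∃ x, R x = T.history b τ f) (m : ℕ)
    {f : ℝ → U} (hf : MemLp f 2 volume) : ∃ x, R x = T.history b (m * τ) f := by
  induction m generalizing f with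
  | zero => exact ⟨0, by simp [history]⟩
  | succ m ih =>
    obtain ⟨x, hx⟩ := hA f hf
    obtain ⟨y, hy⟩ := ih (f := fun x => f (x - τ))
      (hf.comp_measurePreserving (measurePreserving_sub_right volume τ))
    refine ⟨x + T.realMap τ y, ?_⟩
    rw [show ((m + 1 : ℕ) : ℝ) * τ = τ + m * τ by push_cast; ring,
      h.history_add_time b hτ (by positivity) hf, map_add, hx, ← hR.comm_realMap, hy]

/-- The cut-off input vanishes at negative times, so one window length `L` serves all `t ≤ L` and
`t` enters only as a translation. -/
theorem HasDecay.history_indicator_shift (h : T.HasDecay M ω) (b : U →L[𝕜] X) {L t : ℝ}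
    (ht : t ∈ Icc 0 L) {u : ℝ → U} (hu : MemLp u 2 (volume.restrict (Icc 0 L))) :
    T.history b L (fun x => (Icc 0 L).indicator u (t + x)) = T.mild (fun s => b (u s)) t := by
  have hf : MemLp (fun x => (Icc 0 L).indicator u (t + x)) 2 volume :=
    ((memLp_indicator_iff_restrict measurableSet_Icc).2 hu).comp_measurePreserving
      (measurePreserving_add_left volume t)
  rw [history, ← intervalIntegral.integral_add_adjacent_intervals
    (h.intervalIntegrable_history b 0 t hf) (h.intervalIntegrable_history b t L hf)]
  have h2 : ∫ s in t..L, T.realMap s (b ((Icc 0 L).indicator u (t + -s))) = 0 := by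
    rw [intervalIntegral.integral_of_le ht.2]
    refine setIntegral_eq_zero_of_forall_eq_zero fun s hs => ?_
    rw [indicator_of_notMem, map_zero, map_zero]
    exact fun H => by linarith [H.1, hs.1]
  have h1 := intervalIntegral.integral_comp_sub_left (a := 0) (b := t)
    (fun s => T.realMap s (b (u (t - s)))) t
  simp only [sub_zero, sub_self, sub_sub_cancel] at h1
  rw [h2, add_zero, mild, h1]
  refine intervalIntegral.integral_congr fun s hs => ?_
  rw [uIcc_of_le ht.1] at hs
  rw [indicator_of_mem, sub_eq_add_neg]
  exact ⟨by linarith [hs.2], by linarith [hs.1, ht.2]⟩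

variable [CompleteSpace X] [IsScalarTower ℝ 𝕜 X]

theorem IsGeneratorInverse.exists_inputOperator [CompleteSpace U] (h : T.HasDecay M ω)
    (hR : T.IsGeneratorInverse R) {b : U →L[𝕜] X} {L : ℝ} (hL : 0 ≤ L)
    (hA : ∀ f : ℝ → U, MemLp f 2 volume → ∃ x, R x = T.history b L f) :
    ∃ Φ : Lp U 2 (volume : Measure ℝ) →L[𝕜] X, ∀ u : ℝ → U,
      ∀ hu : MemLp ((Icc 0 L).indicator u) 2 volume, ∀ t ∈ Icc 0 L,
        R (Φ (DomAddAct.mk t +ᵥ hu.toLp _)) = T.mild (fun s => b (u s)) t := by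
  have hsm : ∀ (c : 𝕜) (f : ℝ → X), (∫ s in (0 : ℝ)..L, c • f s) =
      c • ∫ s in (0 : ℝ)..L, f s := fun c f => intervalIntegral.integral_smul c f
  let W : Lp U 2 (volume : Measure ℝ) →ₗ[𝕜] X :=
    { toFun := fun f => T.history b L f
      map_add' := fun f g => by
        rw [history_congr b L (Lp.coeFn_add f g), history, history, history,
          ← intervalIntegral.integral_add (h.intervalIntegrable_history b 0 L (Lp.memLp f))
          (h.intervalIntegrable_history b 0 L (Lp.memLp g))]
        simp only [Pi.add_apply, map_add]
      map_smul' := fun c f => by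
        rw [history_congr b L (Lp.coeFn_smul c f), history, history, RingHom.id_apply, ← hsm]
        simp only [Pi.smul_apply, map_smul] }
  obtain ⟨Φ, hΦ⟩ := ContinuousLinearMap.exists_factor_of_range_subset
    (W.mkContinuous _ fun f => h.norm_history_le b hL (Lp.memLp f)) R (hR.injective h)
    fun f => hA f (Lp.memLp f)
  refine ⟨Φ, fun u hu t ht => ?_⟩
  rw [hΦ, DomAddAct.mk_vadd_toLp, ← h.history_indicator_shift b ht
    ((memLp_indicator_iff_restrict measurableSet_Icc).1 hu)]
  exact history_congr b L (MemLp.coeFn_toLp _)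

/-- Translations are isometries of `L²`, so `K = ‖Φ‖` works for every `t` in the window. -/
theorem IsGeneratorInverse.exists_norm_le [CompleteSpace U] (h : T.HasDecay M ω)
    (hR : T.IsGeneratorInverse R) {b : U →L[𝕜] X} {L : ℝ} (hL : 0 ≤ L)
    (hA : ∀ f : ℝ → U, MemLp f 2 volume → ∃ x, R x = T.history b L f) :
    ∃ K, 0 ≤ K ∧ ∀ u : ℝ → U, MemLp u 2 (volume.restrict (Icc 0 L)) → ∀ t ∈ Icc 0 L, ∀ y : X,
      R y = T.mild (fun s => b (u s)) t →
        ‖y‖ ≤ K * (eLpNorm u 2 (volume.restrict (Icc 0 L))).toReal := by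
  obtain ⟨Φ, hΦ⟩ := hR.exists_inputOperator h hL hA
  refine ⟨‖Φ‖, norm_nonneg _, fun u hu t ht y hy => ?_⟩
  have hu' := (memLp_indicator_iff_restrict measurableSet_Icc).2 hu
  have : y = Φ (DomAddAct.mk t +ᵥ hu'.toLp _) := hR.injective h (hy.trans (hΦ u hu' t ht).symm)
  rw [this]
  refine (Φ.le_opNorm _).trans_eq ?_
  rw [DomAddAct.norm_vadd_Lp, Lp.norm_toLp, eLpNorm_indicator_eq_eLpNorm_restrict measurableSet_Icc]

theorem IsGeneratorInverse.exists_continuousOn_state [CompleteSpace U] (h : T.HasDecay M ω)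
    (hR : T.IsGeneratorInverse R) {b : U →L[𝕜] X} {τ : ℝ} (hτ : 0 < τ)
    (hA : ∀ f : ℝ → U, MemLp f 2 volume → ∃ x, R x = T.history b τ f)
    {u : ℝ → U} (hu : MemL2Loc u) :
    ∃ y : ℝ → X, ContinuousOn y (Ici 0) ∧ ∀ t ≥ 0, R (y t) = T.mild (fun s => b (u s)) t := by
  have hloc : ∀ N : ℝ, ∃ L ≥ N, ∃ y : ℝ → X, ContinuousOn y (Icc 0 L) ∧
      ∀ t ∈ Icc 0 L, R (y t) = T.mild (fun s => b (u s)) t := fun N => by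
    obtain ⟨m, hm⟩ := exists_nat_ge (N / τ)
    have hL : (0 : ℝ) ≤ m * τ := by positivity
    obtain ⟨Φ, hΦ⟩ := hR.exists_inputOperator h hL
      fun f hf => hR.exists_eq_history_mul h hτ.le hA m hf
    have hu' := (memLp_indicator_iff_restrict measurableSet_Icc).2 (hu _ hL)
    refine ⟨m * τ, (div_le_iff₀ hτ).1 hm, fun t => Φ (DomAddAct.mk t +ᵥ hu'.toLp _), ?_, hΦ u hu'⟩
    -- Translation is strongly continuous on `Lp` only for finite exponents.
    have : Fact ((2 : ℝ≥0∞) ≠ ∞) := ⟨ENNReal.ofNat_ne_top⟩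
    have hc : Continuous fun t : ℝ => DomAddAct.mk t +ᵥ hu'.toLp _ :=
      (DomAddAct.continuous_mk).vadd continuous_const
    exact (Φ.continuous.comp hc).continuousOn
  have hex : ∀ t : ℝ, ∃ y : X, 0 ≤ t → R y = T.mild (fun s => b (u s)) t := fun t => by
    obtain ⟨L, hL, y, -, hy⟩ := hloc t
    exact ⟨y t, fun ht => hy t ⟨ht, hL⟩⟩
  choose y hy using hex
  refine ⟨y, fun t ht => ?_, fun t ht => hy t ht⟩
  -- The window `[0, L]` with `L ≥ t + 1` is a neighbourhood of `t` in `[0, ∞)`; on it `y` agrees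
  -- with the continuous `z` by injectivity of `R`.
  obtain ⟨L, hL, z, hz, hzR⟩ := hloc (t + 1)
  have heq : ∀ s ∈ Icc 0 L, y s = z s := fun s hs =>
    hR.injective h ((hy s hs.1).trans (hzR s hs).symm)
  refine ((hz.congr heq) t ⟨ht, by linarith⟩).mono_of_mem_nhdsWithin ?_
  rw [← Ici_inter_Iic]
  exact inter_mem self_mem_nhdsWithin (mem_nhdsWithin_of_mem_nhds (Iic_mem_nhds (by linarith)))

end

end C0Semigroup

/-! ### Scalar recursions with factor one half. -/

section Recursion

variable {a c : ℕ → ℝ}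

theorem le_of_half_recursion (ha : ∀ k, a (k + 1) ≤ 1 / 2 * a k + c k) {C : ℝ} (hC : 0 ≤ C)
    (hc : ∀ k, c k ≤ C)
    (k : ℕ) : a k ≤ (1 / 2) ^ k * a 0 + 2 * C := by
  -- This is the exact solution of the recursion with constant forcing `C`, whose fixed point is `2
  -- * C`.
  have h0 : ∀ k, a k ≤ (1 / 2) ^ k * a 0 + 2 * C * (1 - (1 / 2) ^ k) := fun k => by
    induction k with
    | zero => simp
    | succ k ih =>
      rw [pow_succ]
      linarith [ha k, hc k]
  have : 2 * C * (1 - (1 / 2 : ℝ) ^ k) ≤ 2 * C :=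
    mul_le_of_le_one_right (by linarith) (by linarith [pow_pos (one_half_pos (α := ℝ)) k])
  linarith [h0 k]

theorem tendsto_zero_of_half_recursion (ha0 : ∀ k, 0 ≤ a k)
    (ha : ∀ k, a (k + 1) ≤ 1 / 2 * a k + c k) (hc : Tendsto c atTop (𝓝 0)) :
    Tendsto a atTop (𝓝 0) := by
  rw [Metric.tendsto_atTop]
  intro ε hε
  -- Restarted at `N`, the recursion has forcing at most `ε / 4`, which contributes at most `ε / 2`.
  obtain ⟨N, hN⟩ := (hc.eventually_le_const (show 0 < ε / 4 by positivity)).exists_forall_of_atTop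
  have h1 : ∀ j, a (N + j) ≤ (1 / 2) ^ j * a N + 2 * (ε / 4) := fun j =>
    le_of_half_recursion (a := fun j => a (N + j)) (c := fun j => c (N + j))
      (fun k => ha (N + k)) (by positivity) (fun k => hN _ (by omega)) j
  have h2 : Tendsto (fun j : ℕ => (1 / 2 : ℝ) ^ j * a N) atTop (𝓝 0) := by
    simpa using (tendsto_pow_atTop_nhds_zero_of_lt_one (r := (1 / 2 : ℝ))
      (by norm_num) (by norm_num)).mul_const (a N)
  obtain ⟨J, hJ⟩ := (h2.eventually_lt_const (show 0 < ε / 2 by positivity)).exists_forall_of_atTop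
  refine ⟨N + J, fun n hn => ?_⟩
  rw [Real.dist_0_eq_abs, abs_of_nonneg (ha0 n)]
  obtain ⟨j, rfl⟩ := Nat.exists_eq_add_of_le (show N ≤ n by omega)
  linarith [h1 j, hJ j (by omega)]

/-- Keeping `ρ` away from `1/2` avoids resonance. The factor `4` closes the induction: `(1/2) * 4 +
1 = (3/4) * 4`. -/
theorem le_pow_of_half_recursion (ha : ∀ k, a (k + 1) ≤ 1 / 2 * a k + c k)
    {C ρ : ℝ} (hρ : 3 / 4 ≤ ρ) (hc : ∀ k, c k ≤ C * ρ ^ k) (k : ℕ) :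
    a k ≤ (|a 0| + 4 * |C|) * ρ ^ k := by
  induction k with
  | zero => rw [pow_zero, mul_one]; linarith [le_abs_self (a 0), abs_nonneg C]
  | succ k ih =>
    have h1 : (0 : ℝ) ≤ ρ ^ k := by positivity
    have h2 : a (k + 1) ≤ (3 / 4 * (|a 0| + 4 * |C|)) * ρ ^ k := by
      have h3 := mul_le_mul_of_nonneg_right (le_abs_self C) h1
      have h4 := mul_nonneg (abs_nonneg (a 0)) h1
      linarith [ha k, hc k]
    refine h2.trans ?_
    rw [pow_succ]
    have : 0 ≤ (|a 0| + 4 * |C|) * ρ ^ k := by positivity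
    nlinarith

end Recursion

/-! ### `L²` norms of inputs on windows of fixed length. -/

section Window

variable {U : Type*} [NormedAddCommGroup U]

/-- The `L²` norm of `u` on the window `[s, s + L]`. -/
noncomputable def windowNorm (u : ℝ → U) (L s : ℝ) : ℝ :=
  (eLpNorm u 2 (volume.restrict (Icc s (s + L)))).toReal

theorem windowNorm_nonneg (u : ℝ → U) (L s : ℝ) : 0 ≤ windowNorm u L s := ENNReal.toReal_nonneg

theorem measurePreserving_add_left_Icc (s L : ℝ) :
    MeasurePreserving (fun x => s + x) (volume.restrict (Icc 0 L))
      (volume.restrict (Icc s (s + L))) := by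
  have := (measurePreserving_add_left volume s).restrict_preimage
    (measurableSet_Icc (a := s) (b := s + L))
  rwa [preimage_const_add_Icc, sub_self, add_sub_cancel_left] at this

theorem MemL2Loc.memLp_Icc {u : ℝ → U} (hu : MemL2Loc u) {s L : ℝ} (hs : 0 ≤ s) (hL : 0 ≤ L) :
    MemLp u 2 (volume.restrict (Icc s (s + L))) :=
  (hu (s + L) (by positivity)).mono_measure (Measure.restrict_mono (Icc_subset_Icc_left hs) le_rfl)

theorem MemL2Loc.memLp_shift {u : ℝ → U} (hu : MemL2Loc u) {s L : ℝ} (hs : 0 ≤ s) (hL : 0 ≤ L) :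
    MemLp (fun x => u (s + x)) 2 (volume.restrict (Icc 0 L)) :=
  (hu.memLp_Icc hs hL).comp_measurePreserving (measurePreserving_add_left_Icc s L)

theorem MemL2Loc.eLpNorm_shift {u : ℝ → U} (hu : MemL2Loc u) {s L : ℝ} (hs : 0 ≤ s) (hL : 0 ≤ L) :
    (eLpNorm (fun x => u (s + x)) 2 (volume.restrict (Icc 0 L))).toReal = windowNorm u L s :=
  congrArg ENNReal.toReal (eLpNorm_comp_measurePreserving (hu.memLp_Icc hs hL).1
    (measurePreserving_add_left_Icc s L))

theorem windowNorm_le {u : ℝ → U} {L s C : ℝ} (hC : 0 ≤ C)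
    (hu : ∀ᵐ t ∂(volume.restrict (Icc s (s + L))), ‖u t‖ ≤ C) :
    windowNorm u L s ≤ (ENNReal.ofReal L ^ (1 / 2 : ℝ)).toReal * C := by
  have h1 := eLpNorm_le_of_ae_bound (p := 2) hu
  rw [Measure.restrict_apply_univ, Real.volume_Icc, add_sub_cancel_left] at h1
  have h2 := ENNReal.toReal_mono (ENNReal.mul_ne_top
    (ENNReal.rpow_ne_top_of_nonneg (by norm_num) ENNReal.ofReal_ne_top) ENNReal.ofReal_ne_top) h1
  rwa [ENNReal.toReal_mul, ENNReal.toReal_ofReal hC,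
    show (2 : ℝ≥0∞).toReal⁻¹ = 1 / 2 by norm_num] at h2

theorem exists_windowNorm_le_of_memLp_top {u : ℝ → U} (hu : MemLp u ∞ (volume.restrict (Ici 0)))
    (L : ℝ) : ∃ C, ∀ s ≥ 0, windowNorm u L s ≤ C := by
  refine ⟨_, fun s hs => windowNorm_le (C := (eLpNorm u ∞ (volume.restrict (Ici 0))).toReal)
    ENNReal.toReal_nonneg ?_⟩
  refine ae_mono (Measure.restrict_mono (fun x hx => hs.le.trans hx.1) le_rfl) ?_
  have h1 := hu.2.ne
  rw [eLpNorm_exponent_top] at h1 ⊢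
  filter_upwards [ae_le_eLpNormEssSup (f := u) (μ := volume.restrict (Ici 0))] with t ht
  have := ENNReal.toReal_mono h1 ht
  rwa [toReal_enorm] at this

/-- Each window lies in the tail `[kL, ∞)`, and the tails of a convergent integral tend to `0`. -/
theorem tendsto_windowNorm_of_memLp {u : ℝ → U} (hu : MemLp u 2 (volume.restrict (Ici 0)))
    {L : ℝ} (hL : 0 < L) : Tendsto (fun k : ℕ => windowNorm u L (k * L)) atTop (𝓝 0) := by
  have hk : ∀ k : ℕ, (0 : ℝ) ≤ k * L := fun k => by positivity
  have hsub : ∀ k : ℕ, MemLp u 2 (volume.restrict (Ici (k * L))) := fun k =>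
    hu.mono_measure (Measure.restrict_mono (Ici_subset_Ici.2 (hk k)) le_rfl)
  have h1 : Tendsto (fun k : ℕ => ∫ t in Ici (k * L), ‖u t‖ ^ (2 : ℝ≥0∞).toReal) atTop (𝓝 0) := by
    have := Antitone.tendsto_setIntegral (μ := volume) (s := fun k : ℕ => Ici (k * L))
      (f := fun t => ‖u t‖ ^ (2 : ℝ≥0∞).toReal) (fun _ => measurableSet_Ici)
      (fun i j hij => Ici_subset_Ici.2 (by gcongr)) (by
        have := hu.integrable_norm_rpow (by norm_num) (by norm_num)
        simpa [IntegrableOn] using this)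
    have he : ⋂ k : ℕ, Ici ((k : ℝ) * L) = ∅ := by
      refine eq_empty_of_forall_notMem fun x hx => ?_
      obtain ⟨k, hk⟩ := exists_nat_gt (x / L)
      exact absurd (mem_iInter.1 hx k) (not_le.2 ((div_lt_iff₀ hL).1 hk))
    rwa [he, setIntegral_empty] at this
  have h2 := h1.rpow_const (p := (2 : ℝ≥0∞).toReal⁻¹) (Or.inr (by norm_num))
  rw [Real.zero_rpow (by norm_num)] at h2
  refine squeeze_zero (fun k => windowNorm_nonneg _ _ _) (fun k => ?_) h2
  have h3 := congrArg ENNReal.toReal ((hsub k).eLpNorm_eq_integral_rpow_norm (by norm_num)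
    (by norm_num))
  rw [ENNReal.toReal_ofReal (by positivity)] at h3
  rw [← h3]
  exact ENNReal.toReal_mono (hsub k).2.ne
    (eLpNorm_mono_measure _ (Measure.restrict_mono Icc_subset_Ici_self le_rfl))

theorem tendsto_windowNorm_of_tendsto {u : ℝ → U}
    (hu : Tendsto (fun t => ‖u t‖) (atTop ⊓ ae volume) (𝓝 0))
    {L : ℝ} (hL : 0 < L) : Tendsto (fun k : ℕ => windowNorm u L (k * L)) atTop (𝓝 0) := by
  set κ := (ENNReal.ofReal L ^ (1 / 2 : ℝ)).toReal with hκ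
  have hκ0 : 0 ≤ κ := ENNReal.toReal_nonneg
  rw [Metric.tendsto_atTop]
  intro ε hε
  -- Dividing by `κ + 1` makes the final bound `κ * ε / (κ + 1)` strictly less than `ε`.
  have h1 := hu.eventually_le_const (show 0 < ε / (κ + 1) by positivity)
  obtain ⟨s, hs, t, ht, hst⟩ := eventually_inf.1 h1
  obtain ⟨N, hN⟩ := mem_atTop_sets.1 hs
  obtain ⟨K, hK⟩ := exists_nat_ge (N / L)
  refine ⟨K, fun k hk => ?_⟩
  rw [Real.dist_0_eq_abs, abs_of_nonneg (windowNorm_nonneg _ _ _)]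
  have h2 : windowNorm u L (k * L) ≤ κ * (ε / (κ + 1)) := by
    refine windowNorm_le (by positivity) ?_
    filter_upwards [ae_restrict_mem measurableSet_Icc, ae_restrict_of_ae ht] with x hx hxt
    refine hst x ⟨hN x ?_, hxt⟩
    have h3 : (K : ℝ) ≤ k := by exact_mod_cast hk
    have h4 := (div_le_iff₀ hL).1 (hK.trans h3)
    exact h4.trans hx.1
  refine h2.trans_lt ?_
  rw [mul_div_assoc', div_lt_iff₀ (by positivity)]
  nlinarith

theorem windowNorm_le_exp {u : ℝ → U} {M₀ μ₀ : ℝ} (hM₀ : 0 ≤ M₀) (hμ₀ : 0 ≤ μ₀)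
    (hu : ∀ᵐ t ∂(volume.restrict (Ici 0)), ‖u t‖ ≤ M₀ * Real.exp (-μ₀ * t)) (L : ℝ) {s : ℝ}
    (hs : 0 ≤ s) :
    windowNorm u L s ≤ (ENNReal.ofReal L ^ (1 / 2 : ℝ)).toReal * (M₀ * Real.exp (-μ₀ * s)) := by
  refine windowNorm_le (by positivity) ?_
  have h1 := ae_mono (Measure.restrict_mono (fun x (hx : x ∈ Icc s (s + L)) => hs.trans hx.1)
    le_rfl) hu
  filter_upwards [ae_restrict_mem measurableSet_Icc, h1] with x hx hxt
  refine hxt.trans ?_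
  gcongr ?_ * Real.exp ?_
  nlinarith [hx.1]

end Window

/-! ### From estimates on time blocks to all times. -/

/-- `f` decays exponentially on `[0, ∞)`. -/
def ExpDecay {E : Type*} [NormedAddCommGroup E] (f : ℝ → E) : Prop :=
  ∃ M > 0, ∃ μ > 0, ∀ t ≥ 0, ‖f t‖ ≤ M * Real.exp (-μ * t)

theorem ExpDecay.add {E : Type*} [NormedAddCommGroup E] {f g : ℝ → E} (hf : ExpDecay f)
    (hg : ExpDecay g) : ExpDecay fun t => f t + g t := by
  obtain ⟨M, hM, μ, hμ, h⟩ := hf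
  obtain ⟨M', hM', μ', hμ', h'⟩ := hg
  refine ⟨M + M', by positivity, min μ μ', lt_min hμ hμ', fun t ht => ?_⟩
  have h1 : Real.exp (-μ * t) ≤ Real.exp (-min μ μ' * t) :=
    Real.exp_le_exp.2 (by nlinarith [min_le_left μ μ'])
  have h2 : Real.exp (-μ' * t) ≤ Real.exp (-min μ μ' * t) :=
    Real.exp_le_exp.2 (by nlinarith [min_le_right μ μ'])
  calc ‖f t + g t‖ ≤ ‖f t‖ + ‖g t‖ := norm_add_le _ _
    _ ≤ M * Real.exp (-μ * t) + M' * Real.exp (-μ' * t) := add_le_add (h t ht) (h' t ht)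
    _ ≤ M * Real.exp (-min μ μ' * t) + M' * Real.exp (-min μ μ' * t) := by gcongr
    _ = _ := by ring

theorem ExpDecay.sum {E ι : Type*} [NormedAddCommGroup E] {f : ι → ℝ → E} (s : Finset ι)
    (hf : ∀ i ∈ s, ExpDecay (f i)) : ExpDecay fun t => ∑ i ∈ s, f i t := by
  classical
  induction s using Finset.induction_on with
  | empty => exact ⟨1, one_pos, 1, one_pos, fun t _ => by simp; positivity⟩
  | insert i s hi ih =>
    simp only [Finset.sum_insert hi]
    exact (hf i (Finset.mem_insert_self i s)).add
      (ih fun j hj => hf j (Finset.mem_insert_of_mem hj))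

section Blocks

variable {E : Type*} [NormedAddCommGroup E]

theorem exists_floor_decomposition {L : ℝ} (hL : 0 < L) {t : ℝ} (ht : 0 ≤ t) :
    ∃ r ∈ Icc 0 L, t = ⌊t / L⌋₊ * L + r := by
  refine ⟨t - ⌊t / L⌋₊ * L, ⟨?_, ?_⟩, by ring⟩
  · have := (le_div_iff₀ hL).1 (Nat.floor_le (div_nonneg ht hL.le))
    linarith
  · have := (div_lt_iff₀ hL).1 (Nat.lt_floor_add_one (t / L))
    linarith

theorem tendsto_zero_of_blocks {g : ℝ → E} {β : ℕ → ℝ} {L : ℝ} (hL : 0 < L)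
    (hg : ∀ k : ℕ, ∀ r ∈ Icc 0 L, ‖g (k * L + r)‖ ≤ β k) (hβ : Tendsto β atTop (𝓝 0)) :
    Tendsto g atTop (𝓝 0) := by
  have h1 : Tendsto (fun t : ℝ => β ⌊t / L⌋₊) atTop (𝓝 0) :=
    hβ.comp (tendsto_nat_floor_atTop.comp (tendsto_id.atTop_div_const hL))
  refine squeeze_zero_norm' ?_ h1
  filter_upwards [eventually_ge_atTop 0] with t ht
  obtain ⟨r, hr, htr⟩ := exists_floor_decomposition hL ht
  conv_lhs => rw [htr]
  exact hg _ r hr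

theorem expDecay_of_blocks {g : ℝ → E} {β : ℕ → ℝ} {L : ℝ} (hL : 0 < L)
    (hg : ∀ k : ℕ, ∀ r ∈ Icc 0 L, ‖g (k * L + r)‖ ≤ β k) {C ν : ℝ} (hν : 0 < ν)
    (hβ : ∀ k, β k ≤ C * Real.exp (-ν * L) ^ k) : ExpDecay g := by
  -- The factor `exp (ν * L)` absorbs the offset `r ≤ L` of `t` within its block.
  refine ⟨(|C| + 1) * Real.exp (ν * L), by positivity, ν, hν, fun t ht => ?_⟩
  obtain ⟨r, hr, htr⟩ := exists_floor_decomposition hL ht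
  set k := ⌊t / L⌋₊
  rw [htr]
  refine ((hg k r hr).trans (hβ k)).trans ?_
  rw [← Real.exp_nat_mul, mul_assoc, ← Real.exp_add]
  have h1 : Real.exp (k * (-ν * L)) ≤ Real.exp (ν * L + -ν * (k * L + r)) :=
    Real.exp_le_exp.2 (by nlinarith [hr.2])
  exact mul_le_mul (by linarith [le_abs_self C]) h1 (Real.exp_pos _).le (by positivity)

end Blocks

/-- `y` halves over each time step `L`, up to the `L²` norm of the input `u` on that step. -/
structure BlockStable {E U : Type*} [NormedAddCommGroup E] [NormedAddCommGroup U]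
    (u : ℝ → U) (y : ℝ → E) (L M K : ℝ) : Prop where
  length_pos : 0 < L
  bound_nonneg : 0 ≤ M
  gain_nonneg : 0 ≤ K
  step : ∀ k : ℕ, ‖y ((k + 1 : ℕ) * L)‖ ≤ 1 / 2 * ‖y (k * L)‖ + K * windowNorm u L (k * L)
  within : ∀ k : ℕ, ∀ r ∈ Icc 0 L, ‖y (k * L + r)‖ ≤ M * ‖y (k * L)‖ + K * windowNorm u L (k * L)

namespace BlockStable

variable {E U : Type*} [NormedAddCommGroup E] [NormedAddCommGroup U]
  {u : ℝ → U} {y : ℝ → E} {L M K : ℝ}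

theorem bounded (h : BlockStable u y L M K) (hu : MemLp u ∞ (volume.restrict (Ici 0))) :
    ∃ C, ∀ t ≥ 0, ‖y t‖ ≤ C := by
  obtain ⟨C, hC⟩ := exists_windowNorm_le_of_memLp_top hu L
  have hk : ∀ k : ℕ, (0 : ℝ) ≤ k * L := fun k => by have := h.length_pos; positivity
  have hc : ∀ k : ℕ, K * windowNorm u L (k * L) ≤ K * C := fun k =>
    mul_le_mul_of_nonneg_left (hC _ (hk k)) h.gain_nonneg
  have hKC : 0 ≤ K * C := (mul_nonneg h.gain_nonneg (windowNorm_nonneg _ _ _)).trans (hc 0)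
  refine ⟨M * (‖y 0‖ + 2 * (K * C)) + K * C, fun t ht => ?_⟩
  obtain ⟨r, hr, htr⟩ := exists_floor_decomposition h.length_pos ht
  rw [htr]
  refine (h.within _ r hr).trans (add_le_add (mul_le_mul_of_nonneg_left ?_ h.bound_nonneg) (hc _))
  refine (le_of_half_recursion (a := fun k : ℕ => ‖y (k * L)‖) h.step hKC hc _).trans ?_
  simp only [Nat.cast_zero, zero_mul]
  gcongr
  exact mul_le_of_le_one_left (norm_nonneg _) (pow_le_one₀ (by norm_num) (by norm_num))

theorem tendsto_zero (h : BlockStable u y L M K)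
    (hu : Tendsto (fun k : ℕ => windowNorm u L (k * L)) atTop (𝓝 0)) :
    Tendsto y atTop (𝓝 0) := by
  have hc := hu.const_mul K
  rw [mul_zero] at hc
  have ha := tendsto_zero_of_half_recursion (a := fun k : ℕ => ‖y (k * L)‖)
    (fun _ => norm_nonneg _) h.step hc
  have := (ha.const_mul M).add hc
  rw [mul_zero, zero_add] at this
  exact tendsto_zero_of_blocks h.length_pos h.within this

theorem expDecay (h : BlockStable u y L M K) {M₀ μ₀ : ℝ} (hM₀ : 0 < M₀) (hμ₀ : 0 < μ₀)
    (hu : ∀ᵐ t ∂(volume.restrict (Ici 0)), ‖u t‖ ≤ M₀ * Real.exp (-μ₀ * t)) : ExpDecay y := by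
  have hL := h.length_pos
  set κ := (ENNReal.ofReal L ^ (1 / 2 : ℝ)).toReal
  have hκ : 0 ≤ κ := ENNReal.toReal_nonneg
  have hlog : 0 < Real.log (4 / 3) := Real.log_pos (by norm_num)
  -- The first bound keeps the rate below that of the input; the second gives `exp (-ν * L) ≥ 3 /
  -- 4`, as `le_pow_of_half_recursion` requires.
  set ν := min μ₀ (Real.log (4 / 3) / L)
  have hν : 0 < ν := lt_min hμ₀ (by positivity)
  have hρ : 3 / 4 ≤ Real.exp (-ν * L) := by
    have h1 : ν * L ≤ Real.log (4 / 3) := (le_div_iff₀ hL).1 (min_le_right _ _)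
    calc (3 / 4 : ℝ) = Real.exp (-Real.log (4 / 3)) := by
          rw [Real.exp_neg, Real.exp_log (by norm_num)]; norm_num
      _ ≤ _ := Real.exp_le_exp.2 (by linarith)
  have hc : ∀ k : ℕ, K * windowNorm u L (k * L) ≤ K * (κ * M₀) * Real.exp (-ν * L) ^ k :=
    fun k => by
      have hk : (0 : ℝ) ≤ k * L := by positivity
      rw [mul_assoc, mul_assoc]
      refine mul_le_mul_of_nonneg_left ?_ h.gain_nonneg
      refine (windowNorm_le_exp hM₀.le hμ₀.le hu L hk).trans ?_
      rw [← Real.exp_nat_mul]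
      gcongr κ * (M₀ * Real.exp ?_)
      have : ν ≤ μ₀ := min_le_left _ _
      nlinarith
  have ha := le_pow_of_half_recursion (a := fun k : ℕ => ‖y (k * L)‖) h.step hρ hc
  refine expDecay_of_blocks (C := M * (|‖y ((0 : ℕ) * L)‖| + 4 * |K * (κ * M₀)|) + K * (κ * M₀))
    hL h.within hν fun k => ?_
  rw [add_mul, mul_assoc M]
  exact add_le_add (mul_le_mul_of_nonneg_left (ha k) h.bound_nonneg) (hc k)

end BlockStable

theorem MemL2Loc.intervalIntegrable {𝕜 U F : Type*} [NontriviallyNormedField 𝕜]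
    [NormedAddCommGroup U] [NormedSpace 𝕜 U] [NormedAddCommGroup F] [NormedSpace 𝕜 F]
    {u : ℝ → U} (hu : MemL2Loc u) (b : U →L[𝕜] F) {t : ℝ} (ht : 0 ≤ t) :
    IntervalIntegrable (fun s => b (u s)) volume 0 t :=
  (intervalIntegrable_iff_integrableOn_Icc_of_le ht).2
    (b.integrable_comp ((hu t ht).integrable one_le_two))

theorem intervalIntegrable_sum_of_memL2Loc {𝕜 F ι : Type*} {U : ι → Type*} [Fintype ι]
    [NontriviallyNormedField 𝕜] [∀ i, NormedAddCommGroup (U i)] [∀ i, NormedSpace 𝕜 (U i)]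
    [NormedAddCommGroup F] [NormedSpace 𝕜 F] (b : ∀ i, U i →L[𝕜] F) {u : ∀ i, ℝ → U i}
    (hu : ∀ i, MemL2Loc (u i)) {t : ℝ} (ht : 0 ≤ t) :
    IntervalIntegrable (fun s => ∑ i, b i (u i s)) volume 0 t :=
  have h := fun i => (hu i).intervalIntegrable (b i) ht
  ⟨integrable_finsetSum _ fun i _ => (h i).1, integrable_finsetSum _ fun i _ => (h i).2⟩

/-! ### Block stability of the states, existence and uniqueness. -/

namespace C0Semigroup

section

variable {𝕜 X : Type*} [RCLike 𝕜] [NormedAddCommGroup X] [InnerProductSpace 𝕜 X]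
  {T : C0Semigroup 𝕜 X} {M ω : ℝ} {R : X →L[𝕜] X}
  {U : Type*} [NormedAddCommGroup U] [NormedSpace 𝕜 U]

theorem HasDecay.expDecay_orbit (h : T.HasDecay M ω) (x : X) :
    ExpDecay fun t => T.realMap t x :=
  ⟨M * ‖x‖ + 1, by have := h.pos; positivity, ω, h.rate_pos, fun t ht => by
    refine (h.norm_realMap_le ht x).trans ?_
    nlinarith [Real.exp_pos (-ω * t)]⟩

theorem _root_.ExpDecay.tendsto {E : Type*} [NormedAddCommGroup E] {f : ℝ → E} (hf : ExpDecay f) :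
    Tendsto f atTop (𝓝 0) := by
  obtain ⟨M, hM, μ, hμ, h⟩ := hf
  have h1 : Tendsto (fun t => M * Real.exp (-μ * t)) atTop (𝓝 0) := by
    have := (Real.tendsto_exp_atBot.comp
      (tendsto_id.const_mul_atTop_of_neg (neg_lt_zero.2 hμ))).const_mul M
    simpa using this
  refine squeeze_zero_norm' ?_ h1
  filter_upwards [eventually_ge_atTop 0] with t ht using h t ht

theorem _root_.ExpDecay.bounded {E : Type*} [NormedAddCommGroup E] {f : ℝ → E} (hf : ExpDecay f) :
    ∃ C, ∀ t ≥ 0, ‖f t‖ ≤ C := by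
  obtain ⟨M, hM, μ, hμ, h⟩ := hf
  refine ⟨M, fun t ht => (h t ht).trans (mul_le_of_le_one_right hM.le ?_)⟩
  exact Real.exp_le_one_iff.2 (by nlinarith)

variable [NormedSpace ℝ X] [CompleteSpace X]

theorem HasDecay.mild_add_time (h : T.HasDecay M ω) {v : ℝ → X} {s t : ℝ} (hs : 0 ≤ s) (ht : 0 ≤ t)
    (hv : IntervalIntegrable v volume 0 (s + t)) :
    T.mild v (s + t) = T.realMap t (T.mild v s) + T.mild (fun r => v (s + r)) t := by
  have hst : s ≤ s + t := by linarith
  have h0 : IntervalIntegrable v volume 0 s :=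
    hv.mono_set (by rw [uIcc_of_le hs, uIcc_of_le (hs.trans hst)]; exact Icc_subset_Icc_right hst)
  have h1 : IntervalIntegrable v volume s (s + t) :=
    hv.mono_set (by rw [uIcc_of_le hst, uIcc_of_le (hs.trans hst)]; exact Icc_subset_Icc_left hs)
  rw [mild, ← intervalIntegral.integral_add_adjacent_intervals
    (h.intervalIntegrable_realMap (g := fun r => s + t - r) (by fun_prop) h0)
    (h.intervalIntegrable_realMap (g := fun r => s + t - r) (by fun_prop) h1)]
  refine congrArg₂ (· + ·) ?_ ?_
  · rw [mild, ← ContinuousLinearMap.intervalIntegral_comp_comm _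
      (h.intervalIntegrable_realMap (by fun_prop) h0)]
    refine intervalIntegral.integral_congr fun r hr => ?_
    rw [uIcc_of_le hs] at hr
    rw [← T.realMap_add ht (by linarith [hr.2])]
    congr 2
    ring
  · have := intervalIntegral.integral_comp_add_left (a := 0) (b := t)
      (fun r => T.realMap (s + t - r) (v r)) s
    rw [add_zero] at this
    rw [← this, mild]
    simp only [add_sub_add_left_eq_sub]

variable [IsScalarTower ℝ 𝕜 X]

theorem IsGeneratorInverse.exists_blockStable [CompleteSpace U] (h : T.HasDecay M ω)
    (hR : T.IsGeneratorInverse R) {b : U →L[𝕜] X} {τ : ℝ} (hτ : 0 < τ)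
    (hA : ∀ f : ℝ → U, MemLp f 2 volume → ∃ x, R x = T.history b τ f)
    {u : ℝ → U} (hu : MemL2Loc u) {y : ℝ → X}
    (hy : ∀ t ≥ 0, R (y t) = T.mild (fun s => b (u s)) t) :
    ∃ L K, BlockStable u y L M K := by
  -- The step must be a multiple of `τ`, where the input operator is available, and long enough for
  -- `T` to halve norms.
  obtain ⟨m, hm0, hm⟩ : ∃ m : ℕ, 0 < m ∧ M * Real.exp (-ω * (m * τ)) ≤ 1 / 2 := by
    have h1 : Tendsto (fun m : ℕ => M * Real.exp (-ω * (m * τ))) atTop (𝓝 0) := by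
      have := (Real.tendsto_exp_atBot.comp ((tendsto_natCast_atTop_atTop.atTop_mul_const
        hτ).const_mul_atTop_of_neg (neg_lt_zero.2 h.rate_pos))).const_mul M
      simpa using this
    exact ((eventually_gt_atTop 0).and (h1.eventually_le_const (by norm_num))).exists
  have hL : (0 : ℝ) < m * τ := by positivity
  obtain ⟨K, hK, hKb⟩ := hR.exists_norm_le h hL.le
    fun f hf => hR.exists_eq_history_mul h hτ.le hA m hf
  set L := (m : ℝ) * τ
  -- The difference is the state reached from zero by the input shifted by `s`, so the gain `K` does
  -- not depend on `s`.
  have key : ∀ s ≥ 0, ∀ t ∈ Icc 0 L, ‖y (s + t) - T.realMap t (y s)‖ ≤ K * windowNorm u L s := by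
    intro s hs t ht
    rw [← hu.eLpNorm_shift hs hL.le]
    refine hKb _ (hu.memLp_shift hs hL.le) t ht _ ?_
    rw [map_sub, hy _ (add_nonneg hs ht.1), ← hR.comm_realMap, hy _ hs,
      h.mild_add_time hs ht.1 (hu.intervalIntegrable b (add_nonneg hs ht.1)), add_sub_cancel_left]
  have hn : ∀ s t, ‖y (s + t)‖ ≤ ‖T.realMap t (y s)‖ + ‖y (s + t) - T.realMap t (y s)‖ :=
    fun s t => by simpa using norm_add_le (T.realMap t (y s)) (y (s + t) - T.realMap t (y s))
  refine ⟨L, K, hL, h.pos.le, hK, fun k => ?_, fun k r hr => ?_⟩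
  · have hk : (0 : ℝ) ≤ k * L := by positivity
    rw [show ((k + 1 : ℕ) : ℝ) * L = k * L + L by push_cast; ring]
    refine (hn _ _).trans (add_le_add ?_ (key _ hk L ⟨hL.le, le_rfl⟩))
    exact (h.norm_realMap_le hL.le _).trans (by gcongr)
  · have hk : (0 : ℝ) ≤ k * L := by positivity
    exact (hn _ _).trans (add_le_add (h.norm_toFun_le _ _) (key _ hk r hr))

/-- One state `y i` is kept per input, so that different inputs may decay for different reasons. -/
theorem IsGeneratorInverse.exists_solution (h : T.HasDecay M ω) (hR : T.IsGeneratorInverse R)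
    {n : ℕ} {U : Fin n → Type*} [∀ i, NormedAddCommGroup (U i)]
    [∀ i, InnerProductSpace 𝕜 (U i)] [∀ i, CompleteSpace (U i)]
    (B : ∀ i, U i →L[𝕜] T.Xneg) (hB : ∀ i, T.Admissible (B i))
    (x₀ : X) {u : ∀ i, ℝ → U i} (hu : ∀ i, MemL2Loc (u i)) :
    ∃ y : Fin n → ℝ → X, (∀ i, ContinuousOn (y i) (Ici 0)) ∧ (∀ i, y i 0 = 0) ∧
      T.IsSolution (fun t => ∑ i, B i (u i t)) (fun t => T.realMap t x₀ + ∑ i, y i t) ∧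
      ∀ i, ∃ L K, BlockStable (u i) (y i) L M K := by
  -- `b i = A⁻¹ B i` is bounded into `X`.
  let b : ∀ i, U i →L[𝕜] X := fun i => ((hR.genEquiv h).symm : T.Xneg →L[𝕜] X).comp (B i)
  have hb : ∀ i, T.genExt.comp (b i) = B i := fun i => ContinuousLinearMap.ext fun w =>
    (hR.genEquiv h).apply_symm_apply (B i w)
  have hA : ∀ i, ∃ τ > 0, ∀ f : ℝ → U i, MemLp f 2 volume →
      ∃ x, R x = T.history (b i) τ f := fun i => by
    obtain ⟨τ, hτ, H⟩ := hB i
    refine ⟨τ, hτ, fun f hf => exists_eq_history (fun w hw => ?_) hf⟩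
    obtain ⟨x, hx⟩ := H w hw
    rw [← hb, hR.inputMap_eq h, hR.embed_eq h] at hx
    exact ⟨x, (hR.genExt_bijective h).1 hx⟩
  choose τ hτ hA using hA
  have hex := fun i => hR.exists_continuousOn_state h (hτ i) (hA i) (hu i)
  choose y hyc hyR using hex
  have hy0 : ∀ i, y i 0 = 0 := fun i => by
    apply hR.injective h
    rw [hyR i 0 le_rfl, map_zero, mild, intervalIntegral.integral_same]
  refine ⟨y, hyc, hy0, ?_, fun i => hR.exists_blockStable h (hτ i) (hA i) (hu i) (hyR i)⟩
  have hforce : (fun t => ∑ i, B i (u i t)) = fun t => T.genExt (∑ i, b i (u i t)) := by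
    funext t
    rw [map_sum]
    exact Finset.sum_congr rfl fun i _ => by rw [← hb]; rfl
  have hsum : ContinuousOn (fun t => ∑ i, y i t) (Ici 0) :=
    continuousOn_finsetSum _ fun i _ => hyc i
  have hx : ContinuousOn (fun t => T.realMap t x₀ + ∑ i, y i t) (Ici 0) :=
    (h.continuous_realMap x₀).continuousOn.add hsum
  rw [hforce, hR.isSolution_iff h]
  refine ⟨hx.locallyIntegrableOn measurableSet_Ici, R.continuous.comp_continuousOn hx,
    fun t ht => ?_⟩
  have hint : ∀ i, ∀ s ≥ 0, IntervalIntegrable (fun s => b i (u i s)) volume 0 s :=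
    fun i s hs => (hu i).intervalIntegrable (b i) hs
  simp only [hy0, Finset.sum_const_zero, add_zero, realMap_zero]
  refine hR.mild_solution h x₀ hsum (fun s hs => ?_) ht
    (intervalIntegrable_sum_of_memL2Loc b hu ht)
  rw [map_sum, mild]
  simp only [map_sum]
  rw [intervalIntegral.integral_finsetSum fun i _ =>
    h.intervalIntegrable_realMap (by fun_prop) (hint i s hs)]
  exact Finset.sum_congr rfl fun i _ => hyR i s hs

/-- The forcing cancels in the difference. Its integrability allows the two integrals to be
subtracted. -/
theorem IsGeneratorInverse.isSolution_unique (h : T.HasDecay M ω) (hR : T.IsGeneratorInverse R)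
    {f : ℝ → T.Xneg} (hf : ∀ t ≥ 0, IntervalIntegrable f volume 0 t)
    {x y : ℝ → X} (hx : T.IsSolution f x) (hy : T.IsSolution f y) (h0 : y 0 = x 0) {t : ℝ}
    (ht : 0 ≤ t) : y t = x t := by
  have hi : ∀ {z : ℝ → X}, T.IsSolution f z → ∀ t ≥ 0,
      IntervalIntegrable (fun s => T.genExt (z s) + f s) volume 0 t := fun hz t ht => by
    have hz' := intervalIntegrable_of_locallyIntegrableOn hz.locallyIntegrable ht
    exact IntervalIntegrable.add
      ⟨T.genExt.integrable_comp hz'.1, T.genExt.integrable_comp hz'.2⟩ (hf t ht)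
  refine sub_eq_zero.1 (hR.eq_zero_of_eq_integral h (d := fun t => y t - x t)
    (hy.locallyIntegrable.sub hx.locallyIntegrable) (fun t ht => ?_) ht)
  have hy' := hy.eq t ht
  rw [h0] at hy'
  apply (hR.genExt_bijective h).1
  rw [← hR.embed_eq h, map_sub, ← hR.intervalIntegral_genExt h,
    ← sub_sub_sub_cancel_right _ _ (T.embed (x 0)), hy', hx.eq t ht,
    ← intervalIntegral.integral_sub (hi hy t ht) (hi hx t ht)]
  simp only [map_sub, add_sub_add_right_eq_sub]

end

end C0Semigroup

theorem lemma2p1 {𝕜 X : Type*} [RCLike 𝕜] [NormedAddCommGroup X] [InnerProductSpace 𝕜 X]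
    [CompleteSpace X] (T : C0Semigroup 𝕜 X) (hT : T.ExponentiallyStable)
    (n : ℕ) (U : Fin n → Type*) [∀ i, NormedAddCommGroup (U i)]
    [∀ i, InnerProductSpace 𝕜 (U i)] [∀ i, CompleteSpace (U i)]
    (B : ∀ i, U i →L[𝕜] T.Xneg) (hB : ∀ i, T.Admissible (B i))
    (x₀ : X) (u : ∀ i, ℝ → U i) (hu : ∀ i, MemL2Loc (u i)) :
    ∃ x : ℝ → X,
      -- `x` is a solution of the initial value problem, continuous with values in `X`
      (ContinuousOn x (Ici 0) ∧ T.IsSolution (fun t => ∑ i, B i (u i t)) x ∧ x 0 = x₀) ∧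
      -- it is the only solution
      (∀ y : ℝ → X, T.IsSolution (fun t => ∑ i, B i (u i t)) y → y 0 = x₀ →
        ∀ t ≥ 0, y t = x t) ∧
      -- bounded inputs
      ((∀ i, MemLp (u i) ∞ (volume.restrict (Ici 0))) → ∃ C, ∀ t ≥ 0, ‖x t‖ ≤ C) ∧
      -- each input is in `L²` or tends to `0` (up to a null set of times)
      ((∀ i, MemLp (u i) 2 (volume.restrict (Ici 0)) ∨
          Tendsto (fun t => ‖u i t‖) (atTop ⊓ ae volume) (𝓝 0)) →
        Tendsto x atTop (𝓝 0)) ∧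
      -- exponentially decaying inputs
      ((∃ M₀ > 0, ∃ μ₀ > 0, ∀ i, ∀ᵐ t ∂(volume.restrict (Ici 0)),
          ‖u i t‖ ≤ M₀ * Real.exp (-μ₀ * t)) →
        ∃ M > 0, ∃ μ > 0, ∀ t ≥ 0, ‖x t‖ ≤ M * Real.exp (-μ * t)) := by
  -- Bochner integrals in `X` need real scalars, obtained here by restriction from `𝕜`.
  let _ : NormedSpace ℝ X := NormedSpace.restrictScalars ℝ 𝕜 X
  have : IsScalarTower ℝ 𝕜 X := IsScalarTower.restrictScalars ℝ 𝕜 X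
  obtain ⟨M, hM, ω, hω, hb⟩ := hT
  have h : T.HasDecay M ω := ⟨hM, hω, hb⟩
  obtain ⟨R, hR⟩ := h.exists_isGeneratorInverse
  obtain ⟨y, hyc, hy0, hsol, hst⟩ := hR.exists_solution h B hB x₀ hu
  choose L K hst using hst
  have hx0 : T.realMap 0 x₀ + ∑ i, y i 0 = x₀ := by simp [hy0, T.realMap_zero]
  refine ⟨fun t => T.realMap t x₀ + ∑ i, y i t, ⟨?_, hsol, hx0⟩, ?_, ?_, ?_, ?_⟩
  · exact (h.continuous_realMap x₀).continuousOn.add (continuousOn_finsetSum _ fun i _ => hyc i)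
  · intro z hz hz0 t ht
    exact hR.isSolution_unique h (fun t ht => intervalIntegrable_sum_of_memL2Loc B hu ht)
      hsol hz (hz0.trans hx0.symm) ht
  · intro H
    obtain ⟨C₀, hC₀⟩ := (h.expDecay_orbit x₀).bounded
    choose C hC using fun i => (hst i).bounded (H i)
    exact ⟨C₀ + ∑ i, C i, fun t ht => (norm_add_le _ _).trans
      (add_le_add (hC₀ t ht) (norm_sum_le_of_le _ fun i _ => hC i t ht))⟩
  · intro H
    have h1 : Tendsto (fun t => ∑ i, y i t) atTop (𝓝 (∑ _i : Fin n, 0)) :=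
      tendsto_finsetSum _ fun i _ => (hst i).tendsto_zero <| (H i).elim
        (fun hi => tendsto_windowNorm_of_memLp hi (hst i).length_pos)
        (fun hi => tendsto_windowNorm_of_tendsto hi (hst i).length_pos)
    simpa using (h.expDecay_orbit x₀).tendsto.add h1
  · rintro ⟨M₀, hM₀, μ₀, hμ₀, H⟩
    exact (h.expDecay_orbit x₀).add
      (ExpDecay.sum _ fun i _ => (hst i).expDecay hM₀ hμ₀ (H i))
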